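/- Let $k$ be an algebraically closed field of characteristic zero; all coalgebras are coassociative, counital and cocommutative $k$-coalgebras. For a finite-dimensional $k$-vector space $W$ of dimension $n$, let $R=\operatorname{Sym}(W^*)$, and for $P\in W$ let $\mathfrak m_P\subseteq R$ be the corresponding maximal ideal and $\operatorname{LC}(W,P)=H^n_{\mathfrak m_P}(R,\Omega^n_{R/k})$. Choose a basis $e_1,\dots,e_n$ of $W$ with dual basis $x_1,\dots,x_n$, and put $z_i=x_i-P_i$. Then $\operatorname{LC}(W,P)$ is the direct limit over $a$ of the modules $\Omega^n/(z_1^a,\dots,z_n^a)\Omega^n$ along multiplication by powers of $z_1\cdots z_n$; the class of $\omega$ at stage $a$ is written $\left[\frac{\omega}{z_1^a,\dots,z_n^a}\right]$, and similarly for denominators $z_1^{c_1},\dots,z_n^{c_n}$. The generalised fractions $\left[\frac{dz_1\wedge\cdots\wedge dz_n}{z_1^{a_1+1},\dots,z_n^{a_n+1}}\right]$ with $a_1,\dots,a_n\ge 0$ form a $k$-basis. The residue $\operatorname{res}_P:\operatorname{LC}(W,P)\to k$ is the linear map with value $1$ on the basis element with $a_1=\dots=a_n=0$ and $0$ on the others.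 There is a linear isomorphism $\operatorname{Sym}(W)\cong\operatorname{LC}(W,P)$, $\nu_1\cdots\nu_s\mapsto|\nu_1,\dots,\nu_s\rangle_P$, which sends $e_1^{a_1}\cdots e_n^{a_n}$ to $a_1!\cdots a_n!\left[\frac{dz_1\wedge\cdots\wedge dz_n}{z_1^{a_1+1},\dots,z_n^{a_n+1}}\right]$, and $\operatorname{LC}(W,P)$ is a coalgebra with counit $\operatorname{res}_P$ and coproduct $\Delta|\nu_1,\dots,\nu_s\rangle_P=\sum_{I\subseteq\{1,\dots,s\}}|\nu_I\rangle_P\otimes|\nu_{I^c}\rangle_P$. (None of this depends on the basis.) Define the coalgebra $${!}W=\bigoplus_{P\in W}\operatorname{LC}(W,P)$$ and the dereliction $d_W:{!}W\to W$ by $d_W(\eta)=\sum_i\operatorname{res}_P(x_i\eta)\,e_i$ for $\eta\in\operatorname{LC}(W,P)$. A linear map $\psi:W\to W'$ of finite-dimensional spaces induces the morphism of coalgebras ${!}\psi:{!}W\to{!}W'$, $|\nu_1,\dots,\nu_s\rangle_P\mapsto|\psi(\nu_1),\dots,\psi(\nu_s)\rangle_{\psi(P)}$. Now let $V$ be an arbitrary,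 possibly infinite-dimensional, $k$-vector space, and let $\{V_i\}_{i\in I}$ be the set of its finite-dimensional subspaces, ordered by inclusion. Let ${!}V=\varinjlim_i{!}V_i$ be the direct limit of vector spaces along the maps induced by the inclusions $V_i\subseteq V_j$, with the coproduct and counit induced by those of the ${!}V_i$, and let $d:{!}V\to V$ be the linear map induced by the composites ${!}V_i\xrightarrow{d_{V_i}}V_i\subseteq V$. **Proposition.** The dereliction $d:{!}V\to V$ is universal among linear maps to $V$ from cocommutative coalgebras: ${!}V$ is a cocommutative coalgebra, and for every cocommutative coalgebra $C$ over $k$ and every linear map $\phi:C\to V$ there is a unique morphism of coalgebras $\Phi:C\to{!}V$ with $d\circ\Phi=\phi$. -/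

import Mathlib

open scoped TensorProduct

noncomputable section

namespace CofreeCoalgebra

universe u v w

section LocalCohomology

variable (k : Type u) (V : Type v) [Field k] [AddCommGroup V] [Module k V]

/-- The ring `R = Sym(V^*)` of polynomial functions on `V`. -/
abbrev PolyRing : Type (max u v) := SymmetricAlgebra k (Module.Dual k V)

/-- Linear functionals on `R`, with their `R`-module structure `(r φ)(f) = φ(f r)`. -/
def Functionals : Type (max u v) := PolyRing k V →ₗ[k] k

instance : AddCommGroup (Functionals k V) := inferInstanceAs (AddCommGroup (PolyRing k V →ₗ[k] k))

variable {V} in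
/-- The value of a functional at a polynomial. -/
def Functionals.eval (φ : Functionals k V) : PolyRing k V →ₗ[k] k := φ

variable {V} in
lemma Functionals.ext {φ ψ : Functionals k V}
    (h : ∀ f, Functionals.eval k φ f = Functionals.eval k ψ f) : φ = ψ :=
  LinearMap.ext h

variable {V} in
lemma Functionals.eval_add (φ ψ : Functionals k V) (f : PolyRing k V) :
    Functionals.eval k (φ + ψ) f = Functionals.eval k φ f + Functionals.eval k ψ f := rfl

instance : SMul (PolyRing k V) (Functionals k V) where
  smul r φ := Functionals.eval k φ ∘ₗ LinearMap.mulRight k r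

variable {V} in
lemma Functionals.eval_smul (r : PolyRing k V) (φ : Functionals k V) (f : PolyRing k V) :
    Functionals.eval k (r • φ) f = Functionals.eval k φ (f * r) := rfl

instance : Module (PolyRing k V) (Functionals k V) where
  one_smul φ := Functionals.ext k fun f => by
    rw [Functionals.eval_smul, mul_one]
  mul_smul r s φ := Functionals.ext k fun f => by
    rw [Functionals.eval_smul, Functionals.eval_smul, Functionals.eval_smul]
    congr 1
    ring
  smul_zero r := rfl
  smul_add r φ ψ := rfl
  add_smul r s φ := Functionals.ext k fun f => by
    rw [Functionals.eval_add, Functionals.eval_smul, Functionals.eval_smul, Functionals.eval_smul,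
      mul_add, map_add]
  zero_smul φ := Functionals.ext k fun f => by
    rw [Functionals.eval_smul, mul_zero, map_zero]
    rfl

/-- The dimension `n` of `V`. -/
abbrev dim : ℕ := Module.finrank k V

variable [FiniteDimensional k V]

/-- The chosen basis `e_1, …, e_n` of `V`. -/
abbrev stdBasis : Module.Basis (Fin (dim k V)) k V := Module.finBasis k V

/-- The coordinate function `x_i = e_i^*`, as an element of `R`. -/
def coordFun (i : Fin (dim k V)) : PolyRing k V :=
  SymmetricAlgebra.ι k (Module.Dual k V) ((stdBasis k V).coord i)

variable {V}

/-- The local coordinate `z_i = x_i - P_i` at the point `P`. The `z_i` generate the maximal ideal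
`m_P` of `R`. -/
def localCoord (P : V) (i : Fin (dim k V)) : PolyRing k V :=
  coordFun k V i - algebraMap k (PolyRing k V) ((stdBasis k V).coord i P)

variable (V) in
/-- Top degree differential forms `Ω^n_{R/k}`. -/
abbrev TopForms : Type (max u v) := ⋀[PolyRing k V]^(dim k V) (Ω[PolyRing k V⁄k])

/-- The form `dz_1 ∧ ⋯ ∧ dz_n`. -/
def volForm (P : V) : TopForms k V :=
  exteriorPower.ιMulti (PolyRing k V) (dim k V)
    (fun i => KaehlerDifferential.D k (PolyRing k V) (localCoord k P i))

/-- The ideal `(z_1^a, …, z_n^a)` of `R`. -/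
def powIdeal (P : V) (a : ℕ) : Ideal (PolyRing k V) :=
  Ideal.span (Set.range fun i => localCoord k P i ^ a)

/-- The module `Ω^n / (z_1^a, …, z_n^a) Ω^n`. -/
def FormsMod (P : V) (a : ℕ) : Type (max u v) :=
  TopForms k V ⧸ (powIdeal k P a • (⊤ : Submodule (PolyRing k V) (TopForms k V)))

instance (P : V) (a : ℕ) : AddCommGroup (FormsMod k P a) := Submodule.Quotient.addCommGroup _

instance (P : V) (a : ℕ) : Module (PolyRing k V) (FormsMod k P a) := Submodule.Quotient.module _

/-- Multiplication by `(z_1 ⋯ z_n)^(b-a)`, as a map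
`Ω^n / (z_1^a, …, z_n^a) Ω^n → Ω^n / (z_1^b, …, z_n^b) Ω^n` for `a ≤ b`. -/
def formsTrans (P : V) (a b : ℕ) (h : a ≤ b) :
    FormsMod k P a →ₗ[PolyRing k V] FormsMod k P b :=
  Submodule.mapQ (powIdeal k P a • ⊤) (powIdeal k P b • ⊤)
    (LinearMap.lsmul (PolyRing k V) (TopForms k V) ((∏ i, localCoord k P i) ^ (b - a))) (by
      rw [← Submodule.map_le_iff_le_comap, Submodule.map_smul'', Submodule.smul_le]
      intro r hr x hx
      obtain ⟨y, -, rfl⟩ := hx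
      rw [LinearMap.lsmul_apply, smul_smul]
      refine Submodule.smul_mem_smul ?_ trivial
      revert hr
      refine fun hr => Submodule.span_induction ?_ ?_ ?_ ?_ hr
      · rintro _ ⟨i, rfl⟩
        have h1 : localCoord k P i ^ a * (∏ i, localCoord k P i) ^ (b - a) =
            (∏ j ∈ Finset.univ.erase i, localCoord k P j) ^ (b - a) * localCoord k P i ^ b := by
          rw [← Finset.mul_prod_erase Finset.univ _ (Finset.mem_univ i), mul_pow, ← mul_assoc,
            ← pow_add, Nat.add_sub_cancel' h, mul_comm]
        simp only [h1]
        exact Ideal.mul_mem_left _ _ (Ideal.subset_span ⟨i, rfl⟩)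
      · simp
      · intro x y _ _ hx hy
        rw [add_mul]
        exact add_mem hx hy
      · intro c x _ hx
        rw [smul_eq_mul, mul_assoc]
        exact Ideal.mul_mem_left _ _ hx)

/-- The local cohomology module `LC(V, P) = H^n_{m_P}(Sym(V^*), Ω^n)`, computed from the generators
`z_1, …, z_n` of `m_P` as the direct limit over `a` of `Ω^n / (z_1^a, …, z_n^a) Ω^n` along
multiplication by powers of `z_1 ⋯ z_n`. -/
def LC (P : V) : Type (max u v) :=
  Module.DirectLimit (FormsMod k P) (formsTrans k P)

variable (P : V)

instance : AddCommGroup (LC k P) := inferInstanceAs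
  (AddCommGroup (Module.DirectLimit (FormsMod k P) (formsTrans k P)))

instance : Module (PolyRing k V) (LC k P) := inferInstanceAs
  (Module (PolyRing k V) (Module.DirectLimit (FormsMod k P) (formsTrans k P)))

instance : Module k (LC k P) := Module.compHom _ (algebraMap k (PolyRing k V))

instance : IsScalarTower k (PolyRing k V) (LC k P) :=
  IsScalarTower.of_algebraMap_smul fun _ _ => rfl

/-- The class of a form `ω` in `Ω^n / (z_1^a, …, z_n^a) Ω^n`. -/
def formsMk (a : ℕ) : TopForms k V →ₗ[PolyRing k V] FormsMod k P a :=
  Submodule.mkQ (powIdeal k P a • ⊤)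

lemma formsMk_surjective (a : ℕ) : Function.Surjective (formsMk k P a) :=
  Submodule.mkQ_surjective _

lemma formsTrans_mk {a b : ℕ} (h : a ≤ b) (ω : TopForms k V) :
    formsTrans k P a b h (formsMk k P a ω) =
      formsMk k P b ((∏ i, localCoord k P i) ^ (b - a) • ω) := rfl

/-- The map from `Ω^n / (z_1^a, …, z_n^a) Ω^n` to the direct limit. -/
def LC.of (a : ℕ) : FormsMod k P a →ₗ[PolyRing k V] LC k P :=
  Module.DirectLimit.of (PolyRing k V) ℕ (FormsMod k P) (formsTrans k P) a

/-- The generalised fraction `[ω / z_1^a, …, z_n^a]`. -/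
def frac (a : ℕ) : TopForms k V →ₗ[PolyRing k V] LC k P :=
  LC.of k P a ∘ₗ formsMk k P a

lemma frac_induction {motive : LC k P → Prop} (h : ∀ a ω, motive (frac k P a ω)) (η : LC k P) :
    motive η := by
  refine Module.DirectLimit.induction_on (C := motive) η fun a x => ?_
  obtain ⟨ω, rfl⟩ := formsMk_surjective k P a x
  exact h a ω

lemma frac_eq_zero {a : ℕ} {r : PolyRing k V} (hr : r ∈ powIdeal k P a) (ω : TopForms k V) :
    frac k P a (r • ω) = 0 := by
  have : formsMk k P a (r • ω) = 0 :=
    (Submodule.Quotient.mk_eq_zero _).2 (Submodule.smul_mem_smul hr trivial)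
  rw [frac, LinearMap.comp_apply, this, map_zero]

lemma frac_trans {a b : ℕ} (h : a ≤ b) (ω : TopForms k V) :
    frac k P b ((∏ i, localCoord k P i) ^ (b - a) • ω) = frac k P a ω :=
  Module.DirectLimit.of_f (f := formsTrans k P) (hij := h) (x := formsMk k P a ω)

/-- The generalised fraction `[ω / z_1^(c_1), …, z_n^(c_n)]`, brought to the common exponent
`max c_i`. -/
def genFrac (ω : TopForms k V) (c : Fin (dim k V) → ℕ) : LC k P :=
  frac k P (Finset.univ.sup c) ((∏ i, localCoord k P i ^ (Finset.univ.sup c - c i)) • ω)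

lemma genFrac_eq (ω : TopForms k V) (c : Fin (dim k V) → ℕ) {a : ℕ} (h : ∀ i, c i ≤ a) :
    genFrac k P ω c = frac k P a ((∏ i, localCoord k P i ^ (a - c i)) • ω) := by
  have hs : Finset.univ.sup c ≤ a := Finset.sup_le fun i _ => h i
  rw [genFrac, ← frac_trans k P hs, smul_smul, ← Finset.prod_pow, ← Finset.prod_mul_distrib]
  congr 2
  refine Finset.prod_congr rfl fun i _ => ?_
  have := Finset.le_sup (f := c) (Finset.mem_univ i)
  rw [← pow_add]
  congr 1
  omega

/-- Taylor expansion at `P`: the isomorphism of `R` with the polynomial ring `k[z_1, …, z_n]`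
sending `z_i = x_i - P_i` to the variable `z_i`. -/
def taylor : PolyRing k V ≃ₐ[k] MvPolynomial (Fin (dim k V)) k :=
  (SymmetricAlgebra.equivMvPolynomial (stdBasis k V).dualBasis).trans
    (AlgEquiv.ofAlgHom
      (MvPolynomial.aeval fun i => MvPolynomial.X i + MvPolynomial.C ((stdBasis k V).coord i P))
      (MvPolynomial.aeval fun i => MvPolynomial.X i - MvPolynomial.C ((stdBasis k V).coord i P))
      (by ext i; simp [← MvPolynomial.algebraMap_eq]) (by ext i; simp [← MvPolynomial.algebraMap_eq]))

lemma taylor_coordFun (i : Fin (dim k V)) :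
    taylor k P (coordFun k V i) =
      MvPolynomial.X i + MvPolynomial.C ((stdBasis k V).coord i P) := by
  have : coordFun k V i =
      SymmetricAlgebra.ι k (Module.Dual k V) ((stdBasis k V).dualBasis i) := by
    simp [coordFun]
  rw [this, taylor, AlgEquiv.trans_apply, SymmetricAlgebra.equivMvPolynomial_ι_apply]
  simp

lemma taylor_localCoord (i : Fin (dim k V)) :
    taylor k P (localCoord k P i) = MvPolynomial.X i := by
  rw [localCoord, map_sub, taylor_coordFun, AlgEquiv.commutes, MvPolynomial.algebraMap_eq,
    add_sub_cancel_right]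

lemma taylor_symm_X (i : Fin (dim k V)) :
    (taylor k P).symm (MvPolynomial.X i) = localCoord k P i := by
  rw [← taylor_localCoord, AlgEquiv.symm_apply_apply]

/-- The derivation `∂_i = ∂/∂x_i` of `R` (in the coordinates at `P`, where it is `∂/∂z_i`). -/
def partialDer (i : Fin (dim k V)) : Derivation k (PolyRing k V) (PolyRing k V) :=
  Derivation.mk' ((taylor k P).symm.toLinearMap ∘ₗ (MvPolynomial.pderiv i).toLinearMap ∘ₗ
    (taylor k P).toLinearMap) (by
      intro a b
      simp [Derivation.leibniz])

lemma partialDer_apply (i : Fin (dim k V)) (f : PolyRing k V) :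
    partialDer k P i f = (taylor k P).symm (MvPolynomial.pderiv i (taylor k P f)) := rfl

lemma partialDer_localCoord (i j : Fin (dim k V)) :
    partialDer k P i (localCoord k P j) = if i = j then 1 else 0 := by
  rw [partialDer_apply, taylor_localCoord, MvPolynomial.pderiv_X, Pi.single_apply]
  simp only [eq_comm (a := i)]
  split_ifs <;> simp

/-- The basis `dz_1, …, dz_n` of the module of differentials. -/
def diffBasis : Module.Basis (Fin (dim k V)) (PolyRing k V) (Ω[PolyRing k V⁄k]) :=
  Module.Basis.mk (v := fun i => KaehlerDifferential.D k (PolyRing k V) (localCoord k P i))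
    (by
      rw [Fintype.linearIndependent_iff]
      intro g hg i
      have := congrArg (partialDer k P i).liftKaehlerDifferential hg
      simpa [partialDer_localCoord] using this)
    (by
      rw [← KaehlerDifferential.span_range_derivation, Submodule.span_le]
      rintro _ ⟨f, rfl⟩
      obtain ⟨p, rfl⟩ := (taylor k P).symm.surjective f
      simp only [SetLike.mem_coe]
      induction p using MvPolynomial.induction_on with
      | C a =>
        rw [← MvPolynomial.algebraMap_eq, AlgEquiv.commutes, Derivation.map_algebraMap]
        exact zero_mem _
      | add p q hp hq => rw [map_add, map_add]; exact add_mem hp hq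
      | mul_X p i hp =>
        rw [map_mul, Derivation.leibniz, taylor_symm_X]
        exact add_mem (Submodule.smul_mem _ _ (Submodule.subset_span ⟨i, rfl⟩))
          (Submodule.smul_mem _ _ hp))

lemma diffBasis_apply (i : Fin (dim k V)) :
    diffBasis k P i = KaehlerDifferential.D k (PolyRing k V) (localCoord k P i) := by
  simp [diffBasis]

/-- The coefficient `f` of a top form `f dz_1 ∧ ⋯ ∧ dz_n`. -/
def formCoeff : TopForms k V →ₗ[PolyRing k V] PolyRing k V :=
  exteriorPower.alternatingMapLinearEquiv (diffBasis k P).det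

lemma formCoeff_volForm : formCoeff k P (volForm k P) = 1 := by
  rw [formCoeff, volForm, exteriorPower.alternatingMapLinearEquiv_apply_ιMulti]
  have : (fun i => KaehlerDifferential.D k (PolyRing k V) (localCoord k P i)) = diffBasis k P := by
    funext i; rw [diffBasis_apply]
  rw [this, Module.Basis.det_self]

lemma formCoeff_smul_volForm (ω : TopForms k V) : formCoeff k P ω • volForm k P = ω := by
  have : (LinearMap.toSpanSingleton (PolyRing k V) _ (volForm k P)) ∘ₗ formCoeff k P =
      LinearMap.id := by
    refine exteriorPower.linearMap_ext (Module.Basis.ext_alternating (diffBasis k P) ?_)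
    intro s hs
    obtain ⟨σ, rfl⟩ : ∃ σ : Equiv.Perm (Fin (dim k V)), s = σ :=
      ⟨Equiv.ofBijective s (Finite.injective_iff_bijective.1 hs), rfl⟩
    have h1 : (fun i => diffBasis k P (σ i)) = (diffBasis k P) ∘ σ := rfl
    rw [h1, AlternatingMap.map_perm, AlternatingMap.map_perm]
    congr 1
    have h2 : (exteriorPower.ιMulti (PolyRing k V) (dim k V)) (diffBasis k P) = volForm k P := by
      rw [volForm]; congr 1; funext i; rw [diffBasis_apply]
    rw [LinearMap.compAlternatingMap_apply, LinearMap.compAlternatingMap_apply, h2]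
    simp [formCoeff_volForm]
  exact LinearMap.congr_fun this ω

/-- The exponent vector `(a, …, a)`. -/
def constExp (n a : ℕ) : Fin n →₀ ℕ := Finsupp.equivFunOnFinite.symm fun _ => a

@[simp] lemma constExp_apply (n a : ℕ) (i : Fin n) : constExp n a i = a := rfl

lemma prod_X_pow_eq (n : ℕ) (s : Fin n →₀ ℕ) :
    ∏ i, (MvPolynomial.X i : MvPolynomial (Fin n) k) ^ s i = MvPolynomial.monomial s 1 := by
  rw [MvPolynomial.monomial_eq, Finsupp.prod_fintype _ _ (by simp)]
  simp

/-- The coefficient of `z_1^a ⋯ z_n^a` in `z_1 ⋯ z_n g`, for a polynomial `g`; that is, the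
coefficient of `z_1^(a-1) ⋯ z_n^(a-1)` in `g` (or zero if `a = 0 < n`). -/
def topCoeff (n a : ℕ) : MvPolynomial (Fin n) k →ₗ[k] k :=
  MvPolynomial.lcoeff k (constExp n a) ∘ₗ
    LinearMap.mulLeft k (∏ i, (MvPolynomial.X i : MvPolynomial (Fin n) k))

lemma topCoeff_apply (n a : ℕ) (g : MvPolynomial (Fin n) k) :
    topCoeff k n a g = MvPolynomial.coeff (constExp n a)
      (MvPolynomial.monomial (constExp n 1) 1 * g) := by
  rw [← prod_X_pow_eq]
  simp [topCoeff]

lemma topCoeff_X_pow_mul (n a : ℕ) (i : Fin n) (g : MvPolynomial (Fin n) k) :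
    topCoeff k n a (MvPolynomial.X i ^ a * g) = 0 := by
  rw [topCoeff_apply, MvPolynomial.X_pow_eq_monomial, ← mul_assoc, MvPolynomial.monomial_mul,
    MvPolynomial.coeff_monomial_mul', if_neg]
  intro h
  have := h i
  simp at this

lemma topCoeff_trans (n : ℕ) {a b : ℕ} (h : a ≤ b) (g : MvPolynomial (Fin n) k) :
    topCoeff k n b ((∏ i, MvPolynomial.X i) ^ (b - a) * g) = topCoeff k n a g := by
  have h1 : (∏ i : Fin n, (MvPolynomial.X i : MvPolynomial (Fin n) k)) ^ (b - a) =
      MvPolynomial.monomial (constExp n (b - a)) 1 := by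
    rw [← prod_X_pow_eq, ← Finset.prod_pow]; rfl
  have h2 : constExp n b = constExp n (b - a) + constExp n a := by
    ext i; simp [h]
  rw [topCoeff_apply, topCoeff_apply, h1, mul_left_comm, h2, MvPolynomial.coeff_monomial_mul,
    one_mul]

lemma topCoeff_monomial (n a : ℕ) (s : Fin n →₀ ℕ) (r : k) :
    topCoeff k n a (MvPolynomial.monomial s r) = if (∀ i, s i + 1 = a) then r else 0 := by
  rw [topCoeff_apply, MvPolynomial.monomial_mul, MvPolynomial.coeff_monomial, one_mul]
  congr 1
  rw [Finsupp.ext_iff]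
  simp [add_comm]

/-- The functional `f ↦ res_P (f [ω / z_1^a, …, z_n^a])` for a form `ω = g dz_1 ∧ ⋯ ∧ dz_n`: the
coefficient of `z_1^(a-1) ⋯ z_n^(a-1)` in the expansion of `f g` at `P`. -/
def formsPairing (a : ℕ) : TopForms k V →ₗ[PolyRing k V] Functionals k V where
  toFun ω := topCoeff k (dim k V) a ∘ₗ (taylor k P).toLinearMap ∘ₗ
    LinearMap.mulRight k (formCoeff k P ω)
  map_add' ω ω' := by
    refine Functionals.ext k fun f => ?_
    change topCoeff k _ a (taylor k P (f * formCoeff k P (ω + ω'))) =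
      topCoeff k _ a (taylor k P (f * formCoeff k P ω)) +
        topCoeff k _ a (taylor k P (f * formCoeff k P ω'))
    rw [map_add, mul_add, map_add, map_add]
  map_smul' r ω := by
    refine Functionals.ext k fun f => ?_
    change topCoeff k _ a (taylor k P (f * formCoeff k P (r • ω))) =
      topCoeff k _ a (taylor k P ((f * r) * formCoeff k P ω))
    rw [map_smul, smul_eq_mul, mul_assoc]

lemma eval_formsPairing (a : ℕ) (ω : TopForms k V) (f : PolyRing k V) :
    Functionals.eval k (formsPairing k P a ω) f =
      topCoeff k (dim k V) a (taylor k P (f * formCoeff k P ω)) := rfl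

lemma formsPairing_eq_zero (a : ℕ) {r : PolyRing k V} (hr : r ∈ powIdeal k P a)
    (ω : TopForms k V) : formsPairing k P a (r • ω) = 0 := by
  refine Functionals.ext k fun f => ?_
  rw [eval_formsPairing, map_smul, smul_eq_mul]
  change _ = (0 : k)
  revert f
  refine Submodule.span_induction (p := fun r _ => ∀ f : PolyRing k V,
    topCoeff k (dim k V) a (taylor k P (f * (r * formCoeff k P ω))) = 0) ?_ ?_ ?_ ?_ hr
  · rintro _ ⟨i, rfl⟩ f
    rw [mul_left_comm, map_mul, map_pow, taylor_localCoord, topCoeff_X_pow_mul]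
  · intro f
    rw [zero_mul, mul_zero, map_zero, map_zero]
  · intro x y _ _ hx hy f
    rw [add_mul, mul_add, map_add, map_add, hx, hy, add_zero]
  · intro c x _ hx f
    rw [smul_eq_mul, mul_assoc, ← mul_assoc f]
    exact hx _

lemma formsPairing_trans {a b : ℕ} (h : a ≤ b) (ω : TopForms k V) :
    formsPairing k P b ((∏ i, localCoord k P i) ^ (b - a) • ω) = formsPairing k P a ω := by
  refine Functionals.ext k fun f => ?_
  rw [eval_formsPairing, eval_formsPairing, map_smul, smul_eq_mul, mul_left_comm, map_mul,
    map_pow, map_prod]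
  simp only [taylor_localCoord]
  rw [topCoeff_trans k _ h]

/-- The map `Ω^n / (z_1^a, …, z_n^a) Ω^n → Hom_k(R, k)` induced by `formsPairing`. -/
def formsModPairing (a : ℕ) : FormsMod k P a →ₗ[PolyRing k V] Functionals k V :=
  Submodule.liftQ (powIdeal k P a • ⊤) (formsPairing k P a) (by
    rw [Submodule.smul_le]
    intro r hr ω _
    rw [LinearMap.mem_ker]
    exact formsPairing_eq_zero k P a hr ω)

lemma formsModPairing_mk (a : ℕ) (ω : TopForms k V) :
    formsModPairing k P a (formsMk k P a ω) = formsPairing k P a ω := rfl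

/-- The pairing `η ↦ (f ↦ res_P (f η))`. -/
def resPairing : LC k P →ₗ[PolyRing k V] Functionals k V :=
  Module.DirectLimit.lift (PolyRing k V) ℕ (FormsMod k P) (formsTrans k P) (formsModPairing k P) (by
    intro a b h x
    obtain ⟨ω, rfl⟩ := formsMk_surjective k P a x
    rw [formsTrans_mk, formsModPairing_mk, formsModPairing_mk, formsPairing_trans k P h])

lemma resPairing_frac (a : ℕ) (ω : TopForms k V) :
    resPairing k P (frac k P a ω) = formsPairing k P a ω :=
  (Module.DirectLimit.lift_of (f := formsTrans k P) _ _ (formsMk k P a ω)).trans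
    (formsModPairing_mk k P a ω)

/-- The residue map `res_P : LC(V, P) → k`: in the local coordinates at `P` it sends the generalised
fraction `[g dz_1 ∧ ⋯ ∧ dz_n / z_1^a, …, z_n^a]` to the coefficient of `z_1^(a-1) ⋯ z_n^(a-1)`
in `g`. -/
def residue : LC k P →ₗ[k] k where
  toFun η := Functionals.eval k (resPairing k P η) 1
  map_add' η η' := by rw [map_add, Functionals.eval_add]
  map_smul' c η := by
    rw [← IsScalarTower.algebraMap_smul (PolyRing k V) c η, map_smul, Functionals.eval_smul,
      mul_comm, ← Algebra.smul_def, map_smul, RingHom.id_apply]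

lemma residue_smul_frac (f : PolyRing k V) (a : ℕ) (ω : TopForms k V) :
    residue k P (f • frac k P a ω) =
      topCoeff k (dim k V) a (taylor k P (f * formCoeff k P ω)) := by
  change Functionals.eval k (resPairing k P (f • frac k P a ω)) 1 = _
  rw [map_smul, Functionals.eval_smul, one_mul, resPairing_frac, eval_formsPairing]

/-- The generalised fraction `[1 / z_1^(a_1), …, z_n^(a_n) · dz / z]`, that is
`[dz_1 ∧ ⋯ ∧ dz_n / z_1^(a_1 + 1), …, z_n^(a_n + 1)]`. -/
def basicFrac (a : Fin (dim k V) →₀ ℕ) : LC k P :=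
  genFrac k P (volForm k P) (fun i => a i + 1)

lemma basicFrac_eq (a : Fin (dim k V) →₀ ℕ) {N : ℕ} (h : ∀ i, a i + 1 ≤ N) :
    basicFrac k P a =
      frac k P N ((∏ i, localCoord k P i ^ (N - (a i + 1))) • volForm k P) :=
  genFrac_eq k P _ _ h

lemma taylor_prod (s : Fin (dim k V) → ℕ) :
    taylor k P (∏ i, localCoord k P i ^ s i) =
      MvPolynomial.monomial (Finsupp.equivFunOnFinite.symm s) 1 := by
  rw [← prod_X_pow_eq, map_prod]
  simp [taylor_localCoord]

lemma residue_monomial_smul_basicFrac (a : Fin (dim k V) →₀ ℕ) (b : Fin (dim k V) → ℕ) :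
    residue k P ((∏ i, localCoord k P i ^ b i) • basicFrac k P a) = if ⇑a = b then 1 else 0 := by
  have h : ∀ i, a i + 1 ≤ Finset.univ.sup (fun i => a i + 1) := fun i =>
    Finset.le_sup (f := fun i => a i + 1) (Finset.mem_univ i)
  rw [basicFrac_eq k P a h, residue_smul_frac, map_smul, formCoeff_volForm, smul_eq_mul, mul_one,
    map_mul, taylor_prod, taylor_prod, MvPolynomial.monomial_mul, topCoeff_monomial, one_mul]
  congr 1
  rw [funext_iff]
  refine propext (forall_congr' fun i => ?_)
  have := h i
  simp
  omega

lemma linearIndependent_basicFrac : LinearIndependent k (basicFrac k P) := by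
  rw [linearIndependent_iff]
  intro l hl
  ext a
  have h := congrArg (fun η => residue k P ((∏ i, localCoord k P i ^ a i) • η)) hl
  simp only [smul_zero, map_zero] at h
  rw [Finsupp.linearCombination_apply, Finsupp.sum, Finset.smul_sum, map_sum] at h
  simp only [smul_comm _ (_ : k), map_smul, residue_monomial_smul_basicFrac] at h
  simpa using h

lemma monomial_frac_mem (a : ℕ) (s : Fin (dim k V) →₀ ℕ) :
    frac k P a ((∏ i, localCoord k P i ^ s i) • volForm k P) ∈
      Submodule.span k (Set.range (basicFrac k P)) := by
  by_cases h : ∃ i, a ≤ s i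
  · obtain ⟨i, hi⟩ := h
    rw [frac_eq_zero]
    · exact zero_mem _
    · rw [← Finset.mul_prod_erase Finset.univ _ (Finset.mem_univ i)]
      refine Ideal.mul_mem_right _ _ ?_
      rw [← Nat.add_sub_cancel' hi, pow_add]
      exact Ideal.mul_mem_right _ _ (Ideal.subset_span ⟨i, rfl⟩)
  · push Not at h
    refine Submodule.subset_span ⟨Finsupp.equivFunOnFinite.symm fun i => a - 1 - s i, ?_⟩
    rw [basicFrac_eq k P _ (N := a) (fun i => by have := h i; simp; omega)]
    congr 2
    refine Finset.prod_congr rfl fun i _ => ?_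
    have := h i
    congr 1
    simp
    omega

lemma span_basicFrac : ⊤ ≤ Submodule.span k (Set.range (basicFrac k P)) := by
  rintro η -
  induction η using frac_induction with
  | h a ω =>
    rw [← formCoeff_smul_volForm k P ω]
    obtain ⟨p, hp⟩ := (taylor k P).symm.surjective (formCoeff k P ω)
    rw [← hp]
    clear hp
    induction p using MvPolynomial.induction_on' with
    | add p q hp hq =>
      rw [map_add, add_smul, map_add]
      exact add_mem hp hq
    | monomial s r =>
      have : (taylor k P).symm (MvPolynomial.monomial s r) =
          algebraMap k (PolyRing k V) r * ∏ i, localCoord k P i ^ s i := by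
        rw [AlgEquiv.symm_apply_eq, map_mul, AlgEquiv.commutes, taylor_prod,
          MvPolynomial.algebraMap_eq, MvPolynomial.C_mul_monomial, mul_one]
        congr 2
        ext i
        rfl
      rw [this, mul_smul, map_smul, IsScalarTower.algebraMap_smul]
      exact Submodule.smul_mem _ _ (monomial_frac_mem k P a s)

/-- The basis of `LC(V, P)` formed by the generalised fractions
`[1 / z_1^(a_1), …, z_n^(a_n) · dz / z]`. -/
def fracBasis : Module.Basis (Fin (dim k V) →₀ ℕ) k (LC k P) :=
  Module.Basis.mk (linearIndependent_basicFrac k P) (span_basicFrac k P)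

lemma fracBasis_apply (a : Fin (dim k V) →₀ ℕ) : fracBasis k P a = basicFrac k P a := by
  simp [fracBasis]

section Fock

variable (V) in
/-- The algebra isomorphism `Sym(V) ≅ k[e_1, …, e_n]`. -/
def symEquiv : SymmetricAlgebra k V ≃ₐ[k] MvPolynomial (Fin (dim k V)) k :=
  SymmetricAlgebra.equivMvPolynomial (stdBasis k V)

lemma symEquiv_symm_X (i : Fin (dim k V)) :
    (symEquiv k V).symm (MvPolynomial.X i) = SymmetricAlgebra.ι k V (stdBasis k V i) :=
  SymmetricAlgebra.equivMvPolynomial_symm_X _ i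

lemma counit_symEquiv_symm (p : MvPolynomial (Fin (dim k V)) k) :
    Coalgebra.counit (R := k) ((symEquiv k V).symm p) = MvPolynomial.coeff 0 p := by
  have : (SymmetricAlgebra.algebraMapInv (R := k) (M := V)).comp (symEquiv k V).symm.toAlgHom =
      MvPolynomial.aeval (0 : Fin (dim k V) → k) := by
    refine MvPolynomial.algHom_ext fun i => ?_
    rw [MvPolynomial.aeval_X]
    change SymmetricAlgebra.algebraMapInv ((symEquiv k V).symm (MvPolynomial.X i)) = 0
    rw [symEquiv_symm_X]
    exact SymmetricAlgebra.algebraMapInv_ι (R := k) (M := V) _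
  have h2 := AlgHom.congr_fun this p
  rw [MvPolynomial.aeval_zero] at h2
  exact h2

lemma sym_ext {M : Type w} [AddCommGroup M] [Module k M] {f g : SymmetricAlgebra k V →ₗ[k] M}
    (h : ∀ a, f ((symEquiv k V).symm (MvPolynomial.monomial a 1)) =
      g ((symEquiv k V).symm (MvPolynomial.monomial a 1))) : f = g := by
  refine (stdBasis k V).symmetricAlgebra.ext fun a => ?_
  have : (symEquiv k V).symm (MvPolynomial.monomial a 1) =
      (stdBasis k V).symmetricAlgebra a := by
    simp [symEquiv, Module.Basis.symmetricAlgebra]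
  rw [← this, h]

variable [CharZero k]

/-- The scalar `a_1! ⋯ a_n!`, which is a unit in characteristic zero. -/
def factorialUnit {n : ℕ} (a : Fin n →₀ ℕ) : kˣ :=
  Units.mk0 (∏ i, ((a i).factorial : k))
    (Finset.prod_ne_zero_iff.2 fun i _ => Nat.cast_ne_zero.2 (Nat.factorial_ne_zero (a i)))

/-- The linear isomorphism `Sym(V) ≅ LC(V, P)`, `ν_1 ⋯ ν_s ↦ |ν_1, …, ν_s⟩_P`. On a monomial
`e_1^(a_1) ⋯ e_n^(a_n)` it is given by
`|e_1, …, e_1, …, e_n, …, e_n⟩_P = a_1! ⋯ a_n! [1 / z_1^(a_1), …, z_n^(a_n) · dz / z]`,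
the result of applying `(∂/∂x_1)^(a_1) ⋯ (∂/∂x_n)^(a_n)` (acting by the transpose of its action on
`R` under the residue pairing) to the vacuum `|0⟩_P = [dz / z]`. -/
def fock : SymmetricAlgebra k V ≃ₗ[k] LC k P :=
  (stdBasis k V).symmetricAlgebra.equiv ((fracBasis k P).unitsSMul (factorialUnit k)) (Equiv.refl _)

lemma fock_monomial (a : Fin (dim k V) →₀ ℕ) :
    fock k P ((symEquiv k V).symm (MvPolynomial.monomial a 1)) =
      (∏ i, ((a i).factorial : k)) • basicFrac k P a := by
  have : (symEquiv k V).symm (MvPolynomial.monomial a 1) =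
      (stdBasis k V).symmetricAlgebra a := by
    simp [symEquiv, Module.Basis.symmetricAlgebra]
  rw [this, fock, Module.Basis.equiv_apply, Equiv.refl_apply, Module.Basis.unitsSMul_apply,
    fracBasis_apply]
  rfl

lemma residue_fock (s : SymmetricAlgebra k V) :
    residue k P (fock k P s) = Coalgebra.counit (R := k) s := by
  suffices residue k P ∘ₗ (fock k P).toLinearMap = Coalgebra.counit (R := k) from
    LinearMap.congr_fun this s
  refine sym_ext k fun a => ?_
  rw [counit_symEquiv_symm, LinearMap.comp_apply, LinearEquiv.coe_coe, fock_monomial, map_smul]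
  have h := residue_monomial_smul_basicFrac k P a (fun _ => 0)
  simp only [pow_zero, Finset.prod_const_one, one_smul] at h
  rw [h, MvPolynomial.coeff_monomial]
  by_cases ha : a = 0
  · subst ha
    simp
    rfl
  · rw [if_neg ha, if_neg, smul_zero]
    intro h0
    exact ha (DFunLike.coe_injective h0)

/-- The coalgebra structure of `LC(V, P)`: the coproduct is
`Δ |ν_1, …, ν_s⟩ = ∑_I |ν_I⟩ ⊗ |ν_(I^c)⟩`, which is the coproduct of `Sym(V)` carried over along
`ν_1 ⋯ ν_s ↦ |ν_1, …, ν_s⟩`, and the counit is the residue. -/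
instance : CoalgebraStruct k (LC k P) where
  comul := TensorProduct.map (fock k P).toLinearMap (fock k P).toLinearMap ∘ₗ
    Coalgebra.comul ∘ₗ (fock k P).symm.toLinearMap
  counit := residue k P

lemma comul_fock (s : SymmetricAlgebra k V) :
    Coalgebra.comul (R := k) (fock k P s) =
      TensorProduct.map (fock k P).toLinearMap (fock k P).toLinearMap
        (Coalgebra.comul (R := k) s) := by
  change TensorProduct.map _ _ (Coalgebra.comul ((fock k P).symm (fock k P s))) = _
  rw [LinearEquiv.symm_apply_apply]

lemma counit_fock (s : SymmetricAlgebra k V) :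
    Coalgebra.counit (R := k) (fock k P s) = Coalgebra.counit (R := k) s :=
  residue_fock k P s

lemma comul_comp_fock :
    Coalgebra.comul (R := k) ∘ₗ (fock k P).toLinearMap =
      TensorProduct.map (fock k P).toLinearMap (fock k P).toLinearMap ∘ₗ Coalgebra.comul (R := k) :=
  LinearMap.ext fun s => comul_fock k P s

lemma counit_comp_fock :
    Coalgebra.counit (R := k) ∘ₗ (fock k P).toLinearMap = Coalgebra.counit (R := k) :=
  LinearMap.ext fun s => counit_fock k P s

end Fock

end LocalCohomology

section Transport

variable {k : Type u} [Field k] {A : Type v} {B : Type w} [AddCommGroup A] [Module k A]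
  [Coalgebra k A] [AddCommGroup B] [Module k B] [CoalgebraStruct k B] (g : A →ₗ[k] B)

lemma coassoc_comp_of_comul
    (h : Coalgebra.comul (R := k) ∘ₗ g = TensorProduct.map g g ∘ₗ Coalgebra.comul (R := k)) :
    ((TensorProduct.assoc k B B B).toLinearMap ∘ₗ
      (Coalgebra.comul (R := k)).rTensor B ∘ₗ Coalgebra.comul (R := k)) ∘ₗ g =
    ((Coalgebra.comul (R := k)).lTensor B ∘ₗ Coalgebra.comul (R := k)) ∘ₗ g := by
  have h1 : (Coalgebra.comul (R := k) (A := B)).rTensor B ∘ₗ TensorProduct.map g g =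
      TensorProduct.map (TensorProduct.map g g) g ∘ₗ
        (Coalgebra.comul (R := k) (A := A)).rTensor A := by
    rw [LinearMap.rTensor_comp_map, h, ← LinearMap.map_comp_rTensor]
  have h2 : (Coalgebra.comul (R := k) (A := B)).lTensor B ∘ₗ TensorProduct.map g g =
      TensorProduct.map g (TensorProduct.map g g) ∘ₗ
        (Coalgebra.comul (R := k) (A := A)).lTensor A := by
    rw [LinearMap.lTensor_comp_map, h, ← LinearMap.map_comp_lTensor]
  rw [LinearMap.comp_assoc, LinearMap.comp_assoc, LinearMap.comp_assoc, h,
    ← LinearMap.comp_assoc _ _ (LinearMap.lTensor _ _), h2,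
    ← LinearMap.comp_assoc _ _ (LinearMap.rTensor _ _), h1, LinearMap.comp_assoc,
    LinearMap.comp_assoc, ← Coalgebra.coassoc, ← LinearMap.comp_assoc, ← LinearMap.comp_assoc,
    ← TensorProduct.map_map_comp_assoc_eq]
  rfl

lemma rTensor_comp_of_comul
    (h : Coalgebra.comul (R := k) ∘ₗ g = TensorProduct.map g g ∘ₗ Coalgebra.comul (R := k))
    (h' : Coalgebra.counit (R := k) ∘ₗ g = Coalgebra.counit (R := k)) :
    ((Coalgebra.counit (R := k)).rTensor B ∘ₗ Coalgebra.comul (R := k)) ∘ₗ g =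
      TensorProduct.mk k k B 1 ∘ₗ g := by
  rw [LinearMap.comp_assoc, h, ← LinearMap.comp_assoc, LinearMap.rTensor_comp_map, h',
    ← LinearMap.lTensor_comp_rTensor, LinearMap.comp_assoc,
    Coalgebra.rTensor_counit_comp_comul, LinearMap.lTensor_comp_mk]

lemma lTensor_comp_of_comul
    (h : Coalgebra.comul (R := k) ∘ₗ g = TensorProduct.map g g ∘ₗ Coalgebra.comul (R := k))
    (h' : Coalgebra.counit (R := k) ∘ₗ g = Coalgebra.counit (R := k)) :
    ((Coalgebra.counit (R := k)).lTensor B ∘ₗ Coalgebra.comul (R := k)) ∘ₗ g =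
      (TensorProduct.mk k B k).flip 1 ∘ₗ g := by
  rw [LinearMap.comp_assoc, h, ← LinearMap.comp_assoc, LinearMap.lTensor_comp_map, h',
    ← LinearMap.rTensor_comp_lTensor, LinearMap.comp_assoc,
    Coalgebra.lTensor_counit_comp_comul, LinearMap.rTensor_comp_flip_mk]

end Transport

section Bang

variable (k : Type u) (V : Type v) [Field k] [CharZero k] [AddCommGroup V] [Module k V]
  [FiniteDimensional k V]

instance (P : V) : Coalgebra k (LC k P) where
  coassoc := (LinearMap.cancel_right (fock k P).surjective).1
    (coassoc_comp_of_comul (fock k P).toLinearMap (comul_comp_fock k P))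
  rTensor_counit_comp_comul := (LinearMap.cancel_right (fock k P).surjective).1
    (rTensor_comp_of_comul (fock k P).toLinearMap (comul_comp_fock k P) (counit_comp_fock k P))
  lTensor_counit_comp_comul := (LinearMap.cancel_right (fock k P).surjective).1
    (lTensor_comp_of_comul (fock k P).toLinearMap (comul_comp_fock k P) (counit_comp_fock k P))

open scoped Classical in
/-- The coalgebra `!V = ⨁_{P ∈ V} LC(V, P)` of a finite-dimensional space `V`. -/
def BangFin : Type (max u v) := Π₀ P : V, LC k P

instance : AddCommGroup (BangFin k V) := inferInstanceAs (AddCommGroup (Π₀ P : V, LC k P))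

instance : Module k (BangFin k V) := inferInstanceAs (Module k (Π₀ P : V, LC k P))

open scoped Classical in
instance : Coalgebra k (BangFin k V) := inferInstanceAs (Coalgebra k (Π₀ P : V, LC k P))

variable {V}

open scoped Classical in
/-- The inclusion of the summand `LC(V, P)` in `!V`. -/
def BangFin.incl (P : V) : LC k P →ₗ[k] BangFin k V := DFinsupp.lsingle P

open scoped Classical in
/-- The linear map out of `!V = ⨁_P LC(V, P)` with given components. -/
def BangFin.desc {M : Type w} [AddCommGroup M] [Module k M] (g : ∀ P : V, LC k P →ₗ[k] M) :
    BangFin k V →ₗ[k] M :=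
  DFinsupp.lsum k g

lemma BangFin.desc_comp_incl {M : Type w} [AddCommGroup M] [Module k M]
    (g : ∀ P : V, LC k P →ₗ[k] M) (P : V) :
    BangFin.desc k g ∘ₗ BangFin.incl k P = g P := by
  classical
  exact LinearMap.ext fun η => DFinsupp.lsum_single k g P η

lemma BangFin.hom_ext {M : Type w} [AddCommGroup M] [Module k M] {g h : BangFin k V →ₗ[k] M}
    (H : ∀ P : V, g ∘ₗ BangFin.incl k P = h ∘ₗ BangFin.incl k P) : g = h := by
  classical
  exact DFinsupp.lhom_ext' H

lemma BangFin.comul_comp_incl (P : V) :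
    Coalgebra.comul (R := k) ∘ₗ BangFin.incl k P =
      TensorProduct.map (BangFin.incl k P) (BangFin.incl k P) ∘ₗ Coalgebra.comul (R := k) := by
  classical
  exact DFinsupp.comul_comp_lsingle k V (fun P => LC k P) P

lemma BangFin.counit_comp_incl (P : V) :
    Coalgebra.counit (R := k) ∘ₗ BangFin.incl k P = Coalgebra.counit (R := k) := by
  classical
  exact DFinsupp.counit_comp_lsingle k V (fun P => LC k P) P

/-- The element `|ν_1, …, ν_s⟩_P` of `!V`, as a function of `ν_1 ⋯ ν_s ∈ Sym(V)`. -/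
def ket (P : V) : SymmetricAlgebra k V →ₗ[k] BangFin k V :=
  BangFin.incl k P ∘ₗ (fock k P).toLinearMap

lemma comul_comp_ket (P : V) :
    Coalgebra.comul (R := k) ∘ₗ ket k P =
      TensorProduct.map (ket k P) (ket k P) ∘ₗ Coalgebra.comul (R := k) := by
  rw [ket, ← LinearMap.comp_assoc, BangFin.comul_comp_incl, LinearMap.comp_assoc, comul_comp_fock,
    ← LinearMap.comp_assoc, ← TensorProduct.map_comp]

lemma counit_comp_ket (P : V) :
    Coalgebra.counit (R := k) ∘ₗ ket k P = Coalgebra.counit (R := k) := by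
  rw [ket, ← LinearMap.comp_assoc, BangFin.counit_comp_incl, counit_comp_fock]

lemma ket_hom_ext {M : Type w} [AddCommGroup M] [Module k M] {g h : BangFin k V →ₗ[k] M}
    (H : ∀ P : V, g ∘ₗ ket k P = h ∘ₗ ket k P) : g = h :=
  BangFin.hom_ext k fun P => (LinearMap.cancel_right (fock k P).surjective).1 (H P)

/-- The map `d_P : LC(V, P) → V`, `d_P(η) = ∑_i res_P(x_i η) e_i`. -/
def derelictionAt (P : V) : LC k P →ₗ[k] V :=
  ∑ i, (residue k P ∘ₗ Algebra.lsmul k k (LC k P) (coordFun k V i)).smulRight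
    (stdBasis k V i)

variable (V) in
/-- The dereliction `d = ∑_P d_P : !V → V` of a finite-dimensional space `V`. -/
def derelictionFin : BangFin k V →ₗ[k] V :=
  BangFin.desc k (derelictionAt k)

end Bang

section Functoriality

variable {k : Type u} [Field k] {V W : Type v} [AddCommGroup V] [Module k V]
  [AddCommGroup W] [Module k W]

/-- The algebra morphism `Sym(V) → Sym(W)` induced by a linear map `ψ : V → W`. -/
def symMap (ψ : V →ₗ[k] W) : SymmetricAlgebra k V →ₐ[k] SymmetricAlgebra k W :=
  SymmetricAlgebra.lift (SymmetricAlgebra.ι k W ∘ₗ ψ)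

lemma symMap_ι (ψ : V →ₗ[k] W) (v : V) :
    symMap ψ (SymmetricAlgebra.ι k V v) = SymmetricAlgebra.ι k W (ψ v) :=
  SymmetricAlgebra.lift_ι_apply _ v

lemma counit_symMap (ψ : V →ₗ[k] W) (s : SymmetricAlgebra k V) :
    Coalgebra.counit (R := k) (symMap ψ s) = Coalgebra.counit (R := k) s := by
  have : (Bialgebra.counitAlgHom k (SymmetricAlgebra k W)).comp (symMap ψ) =
      Bialgebra.counitAlgHom k (SymmetricAlgebra k V) := by
    refine SymmetricAlgebra.algHom_ext (LinearMap.ext fun v => ?_)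
    change Coalgebra.counit (R := k) (symMap ψ (SymmetricAlgebra.ι k V v)) =
      Coalgebra.counit (R := k) (SymmetricAlgebra.ι k V v)
    rw [symMap_ι, SymmetricAlgebra.counit_ι, SymmetricAlgebra.counit_ι]
  exact AlgHom.congr_fun this s

lemma comul_symMap (ψ : V →ₗ[k] W) (s : SymmetricAlgebra k V) :
    Coalgebra.comul (R := k) (symMap ψ s) =
      TensorProduct.map (symMap ψ).toLinearMap (symMap ψ).toLinearMap
        (Coalgebra.comul (R := k) s) := by
  have : (Bialgebra.comulAlgHom k (SymmetricAlgebra k W)).comp (symMap ψ) =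
      (Algebra.TensorProduct.map (symMap ψ) (symMap ψ)).comp
        (Bialgebra.comulAlgHom k (SymmetricAlgebra k V)) := by
    refine SymmetricAlgebra.algHom_ext (LinearMap.ext fun v => ?_)
    change Coalgebra.comul (R := k) (symMap ψ (SymmetricAlgebra.ι k V v)) =
      Algebra.TensorProduct.map (symMap ψ) (symMap ψ)
        (Coalgebra.comul (R := k) (SymmetricAlgebra.ι k V v))
    rw [symMap_ι, SymmetricAlgebra.comul_ι, SymmetricAlgebra.comul_ι, map_add,
      Algebra.TensorProduct.map_tmul, Algebra.TensorProduct.map_tmul, map_one, symMap_ι]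
  exact AlgHom.congr_fun this s

variable [CharZero k] [FiniteDimensional k V] [FiniteDimensional k W]

/-- The linear map underlying `!ψ`. -/
def bangFinMapAux (ψ : V →ₗ[k] W) : BangFin k V →ₗ[k] BangFin k W :=
  BangFin.desc k fun P => ket k (ψ P) ∘ₗ (symMap ψ).toLinearMap ∘ₗ (fock k P).symm.toLinearMap

lemma bangFinMapAux_comp_ket (ψ : V →ₗ[k] W) (P : V) :
    bangFinMapAux ψ ∘ₗ ket k P = ket k (ψ P) ∘ₗ (symMap ψ).toLinearMap := by
  rw [ket, ← LinearMap.comp_assoc, bangFinMapAux, BangFin.desc_comp_incl]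
  ext s
  simp

/-- The morphism of coalgebras `!ψ : !V → !W` induced by a linear map `ψ : V → W` of
finite-dimensional spaces, `!ψ |ν_1, …, ν_s⟩_P = |ψ(ν_1), …, ψ(ν_s)⟩_(ψ(P))`. -/
def bangFinMap (ψ : V →ₗ[k] W) : BangFin k V →ₗc[k] BangFin k W where
  __ := bangFinMapAux ψ
  counit_comp := ket_hom_ext k fun P => by
    rw [LinearMap.comp_assoc, bangFinMapAux_comp_ket, ← LinearMap.comp_assoc, counit_comp_ket,
      counit_comp_ket]
    exact LinearMap.ext fun s => counit_symMap ψ s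
  map_comp_comul := ket_hom_ext k fun P => by
    rw [LinearMap.comp_assoc, LinearMap.comp_assoc, comul_comp_ket, bangFinMapAux_comp_ket,
      ← LinearMap.comp_assoc, ← LinearMap.comp_assoc, comul_comp_ket, ← TensorProduct.map_comp,
      bangFinMapAux_comp_ket, TensorProduct.map_comp, LinearMap.comp_assoc, LinearMap.comp_assoc]
    congr 1
    exact (LinearMap.ext fun s => comul_symMap ψ s).symm

lemma bangFinMap_comp_ket (ψ : V →ₗ[k] W) (P : V) :
    (bangFinMap ψ).toLinearMap ∘ₗ ket k P = ket k (ψ P) ∘ₗ (symMap ψ).toLinearMap :=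
  bangFinMapAux_comp_ket ψ P

end Functoriality

section Dereliction

variable (k : Type u) {V : Type v} [Field k] [AddCommGroup V] [Module k V] [FiniteDimensional k V]

variable (V) in
/-- The projection of `Sym(V)` onto its degree one component `V`. -/
def degOne : SymmetricAlgebra k V →ₗ[k] V :=
  ∑ i, (MvPolynomial.lcoeff k (Finsupp.single i 1) ∘ₗ (symEquiv k V).toLinearMap).smulRight
    (stdBasis k V i)

lemma degOne_apply (s : SymmetricAlgebra k V) :
    degOne k V s =
      ∑ i, MvPolynomial.coeff (Finsupp.single i 1) (symEquiv k V s) • stdBasis k V i := by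
  simp [degOne]

lemma coeff_single_mul {n : ℕ} (i : Fin n) (p q : MvPolynomial (Fin n) k) :
    MvPolynomial.coeff (Finsupp.single i 1) (p * q) =
      MvPolynomial.coeff 0 p * MvPolynomial.coeff (Finsupp.single i 1) q +
        MvPolynomial.coeff 0 q * MvPolynomial.coeff (Finsupp.single i 1) p := by
  rw [MvPolynomial.coeff_mul, Finsupp.antidiagonal_single]
  simp [Finset.Nat.antidiagonal_succ, mul_comm]

lemma counit_eq_coeff (s : SymmetricAlgebra k V) :
    Coalgebra.counit (R := k) s = MvPolynomial.coeff 0 (symEquiv k V s) := by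
  rw [← counit_symEquiv_symm, AlgEquiv.symm_apply_apply]

lemma degOne_mul (s t : SymmetricAlgebra k V) :
    degOne k V (s * t) = Coalgebra.counit (R := k) s • degOne k V t +
      Coalgebra.counit (R := k) t • degOne k V s := by
  simp only [degOne_apply, map_mul, coeff_single_mul, counit_eq_coeff, Finset.smul_sum,
    ← Finset.sum_add_distrib, add_smul, mul_smul]

lemma degOne_algebraMap (c : k) : degOne k V (algebraMap k _ c) = 0 := by
  rw [degOne_apply]
  refine Finset.sum_eq_zero fun i _ => ?_
  rw [AlgEquiv.commutes, MvPolynomial.algebraMap_eq, MvPolynomial.coeff_C, if_neg, zero_smul]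
  intro h
  simpa using DFunLike.congr_fun h i

lemma degOne_ι (v : V) : degOne k V (SymmetricAlgebra.ι k V v) = v := by
  suffices degOne k V ∘ₗ SymmetricAlgebra.ι k V = LinearMap.id from LinearMap.congr_fun this v
  refine (stdBasis k V).ext fun j => ?_
  rw [LinearMap.comp_apply, ← symEquiv_symm_X, degOne_apply, AlgEquiv.apply_symm_apply,
    LinearMap.id_apply, Finset.sum_eq_single j]
  · rw [MvPolynomial.X, MvPolynomial.coeff_monomial, if_pos rfl, one_smul]
  · intro i _ hij
    rw [MvPolynomial.X, MvPolynomial.coeff_monomial, if_neg, zero_smul]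
    intro h
    exact hij (Finsupp.single_left_injective one_ne_zero h).symm
  · simp

lemma degOne_symMap {W : Type v} [AddCommGroup W] [Module k W] [FiniteDimensional k W]
    (ψ : V →ₗ[k] W) (s : SymmetricAlgebra k V) :
    degOne k W (symMap ψ s) = ψ (degOne k V s) := by
  induction s using SymmetricAlgebra.induction with
  | algebraMap r => rw [AlgHom.commutes, degOne_algebraMap, degOne_algebraMap, map_zero]
  | ι v => rw [symMap_ι, degOne_ι, degOne_ι]
  | mul a b ha hb =>
    rw [map_mul, degOne_mul, degOne_mul, map_add, map_smul, map_smul, ha, hb, counit_symMap,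
      counit_symMap]
  | add a b ha hb => rw [map_add, map_add, map_add, map_add, ha, hb]

variable [CharZero k]

lemma residue_coordFun_smul_fock (P : V) (i : Fin (dim k V)) (s : SymmetricAlgebra k V) :
    residue k P (coordFun k V i • fock k P s) =
      MvPolynomial.coeff (Finsupp.single i 1) (symEquiv k V s) +
        (stdBasis k V).coord i P * Coalgebra.counit (R := k) s := by
  have hx : coordFun k V i =
      localCoord k P i + algebraMap k (PolyRing k V) ((stdBasis k V).coord i P) := by
    rw [localCoord, sub_add_cancel]
  rw [hx, add_smul, map_add, IsScalarTower.algebraMap_smul,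
    (residue k P).map_smul ((stdBasis k V).coord i P), residue_fock, smul_eq_mul]
  congr 1
  suffices residue k P ∘ₗ Algebra.lsmul k k (LC k P) (localCoord k P i) ∘ₗ
      (fock k P).toLinearMap =
      MvPolynomial.lcoeff k (Finsupp.single i 1) ∘ₗ (symEquiv k V).toLinearMap from
    LinearMap.congr_fun this s
  refine sym_ext k fun a => ?_
  have h := residue_monomial_smul_basicFrac k P a (Finsupp.single i 1 : Fin (dim k V) →₀ ℕ)
  have h1 : ∏ j, localCoord k P j ^ (Finsupp.single i 1 : Fin (dim k V) →₀ ℕ) j =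
      localCoord k P i := by
    rw [Finset.prod_eq_single i]
    · simp
    · intro j _ hj
      rw [Finsupp.single_eq_of_ne hj, pow_zero]
    · simp
  rw [h1] at h
  rw [LinearMap.comp_apply, LinearMap.comp_apply, LinearMap.comp_apply, LinearEquiv.coe_coe,
    fock_monomial, map_smul, map_smul, Algebra.lsmul_coe, h, AlgEquiv.toLinearMap_apply,
    AlgEquiv.apply_symm_apply, MvPolynomial.lcoeff_apply, MvPolynomial.coeff_monomial]
  by_cases ha : a = Finsupp.single i 1
  · subst ha
    rw [if_pos rfl, if_pos rfl, smul_eq_mul, mul_one]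
    refine Finset.prod_eq_one fun j _ => ?_
    by_cases hj : j = i
    · subst hj; simp
    · rw [Finsupp.single_eq_of_ne hj]; simp
  · rw [if_neg ha, if_neg, smul_zero]
    exact fun h0 => ha (DFunLike.coe_injective h0)

lemma derelictionAt_fock (P : V) (s : SymmetricAlgebra k V) :
    derelictionAt k P (fock k P s) = Coalgebra.counit (R := k) s • P + degOne k V s := by
  have h : derelictionAt k P (fock k P s) =
      ∑ i, residue k P (coordFun k V i • fock k P s) • stdBasis k V i := by
    simp [derelictionAt]
  rw [h, degOne_apply]
  simp only [residue_coordFun_smul_fock, add_smul, Finset.sum_add_distrib]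
  rw [add_comm]
  congr 1
  conv_rhs => rw [← (stdBasis k V).sum_repr P]
  rw [Finset.smul_sum]
  refine Finset.sum_congr rfl fun i _ => ?_
  rw [mul_comm, mul_smul, Module.Basis.coord_apply]

lemma derelictionFin_ket (P : V) (s : SymmetricAlgebra k V) :
    derelictionFin k V (ket k P s) = Coalgebra.counit (R := k) s • P + degOne k V s := by
  rw [← derelictionAt_fock]
  exact LinearMap.congr_fun (BangFin.desc_comp_incl k (derelictionAt k) P) (fock k P s)

lemma derelictionFin_comp_bangFinMap {W : Type v} [AddCommGroup W] [Module k W]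
    [FiniteDimensional k W] (ψ : V →ₗ[k] W) :
    derelictionFin k W ∘ₗ (bangFinMap ψ).toLinearMap = ψ ∘ₗ derelictionFin k V := by
  refine ket_hom_ext k fun P => ?_
  rw [LinearMap.comp_assoc, bangFinMap_comp_ket]
  refine LinearMap.ext fun s => ?_
  simp only [LinearMap.comp_apply, AlgHom.toLinearMap_apply]
  rw [derelictionFin_ket, derelictionFin_ket, counit_symMap, degOne_symMap, map_add, map_smul]

end Dereliction

section Colimit

variable (k : Type u) (V : Type v) [Field k] [CharZero k] [AddCommGroup V] [Module k V]

/-- The set of finite-dimensional subspaces of `V`, ordered by inclusion. -/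
def FinSub : Type v := {W : Submodule k V // FiniteDimensional k W}

instance : PartialOrder (FinSub k V) := inferInstanceAs
  (PartialOrder {W : Submodule k V // FiniteDimensional k W})

variable {k V}

instance (W : FinSub k V) : FiniteDimensional k W.1 := W.2

/-- The morphism of coalgebras `!W → !W'` induced by an inclusion `W ⊆ W'` of finite-dimensional
subspaces of `V`. -/
def bangTrans (W W' : FinSub k V) (h : W ≤ W') : BangFin k W.1 →ₗc[k] BangFin k W'.1 :=
  bangFinMap (Submodule.inclusion (show W.1 ≤ W'.1 from h))

variable (k V)

open scoped Classical in
/-- For an arbitrary vector space `V`, `!V` is the direct limit of the `!W` over the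
finite-dimensional subspaces `W` of `V`. -/
def Bang : Type (max u v) :=
  Module.DirectLimit (fun W : FinSub k V => BangFin k W.1)
    (fun W W' h => (bangTrans W W' h).toLinearMap)

open scoped Classical in
instance : AddCommGroup (Bang k V) := inferInstanceAs (AddCommGroup
  (Module.DirectLimit (fun W : FinSub k V => BangFin k W.1)
    (fun W W' h => (bangTrans W W' h).toLinearMap)))

open scoped Classical in
instance : Module k (Bang k V) := inferInstanceAs (Module k
  (Module.DirectLimit (fun W : FinSub k V => BangFin k W.1)
    (fun W W' h => (bangTrans W W' h).toLinearMap)))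

variable {V}

open scoped Classical in
/-- The canonical map `!W → !V` for a finite-dimensional subspace `W` of `V`. -/
def Bang.of (W : FinSub k V) : BangFin k W.1 →ₗ[k] Bang k V :=
  Module.DirectLimit.of k (FinSub k V) (fun W : FinSub k V => BangFin k W.1)
    (fun W W' h => (bangTrans W W' h).toLinearMap) W

lemma Bang.of_trans (W W' : FinSub k V) (h : W ≤ W') :
    Bang.of k W' ∘ₗ (bangTrans W W' h).toLinearMap = Bang.of k W := by
  classical
  exact LinearMap.ext fun η => Module.DirectLimit.of_f (R := k)
    (f := fun (W W' : FinSub k V) h => (bangTrans W W' h).toLinearMap)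

open scoped Classical in
/-- The linear map out of the direct limit `!V` given by a compatible family of linear maps. -/
def Bang.desc {M : Type w} [AddCommGroup M] [Module k M]
    (g : ∀ W : FinSub k V, BangFin k W.1 →ₗ[k] M)
    (hg : ∀ (W W' : FinSub k V) (h : W ≤ W'), g W' ∘ₗ (bangTrans W W' h).toLinearMap = g W) :
    Bang k V →ₗ[k] M :=
  Module.DirectLimit.lift k (FinSub k V) (fun W : FinSub k V => BangFin k W.1)
    (fun W W' h => (bangTrans W W' h).toLinearMap) g
    (fun W W' h x => LinearMap.congr_fun (hg W W' h) x)

lemma Bang.desc_comp_of {M : Type w} [AddCommGroup M] [Module k M]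
    (g : ∀ W : FinSub k V, BangFin k W.1 →ₗ[k] M)
    (hg : ∀ (W W' : FinSub k V) (h : W ≤ W'), g W' ∘ₗ (bangTrans W W' h).toLinearMap = g W)
    (W : FinSub k V) : Bang.desc k g hg ∘ₗ Bang.of k W = g W := by
  classical
  exact LinearMap.ext fun η => Module.DirectLimit.lift_of
    (f := fun (W W' : FinSub k V) h => (bangTrans W W' h).toLinearMap) g
    (fun W W' h x => LinearMap.congr_fun (hg W W' h) x) η

lemma Bang.hom_ext {M : Type w} [AddCommGroup M] [Module k M] {g h : Bang k V →ₗ[k] M}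
    (H : ∀ W : FinSub k V, g ∘ₗ Bang.of k W = h ∘ₗ Bang.of k W) : g = h := by
  classical
  exact Module.DirectLimit.hom_ext (R := k)
    (f := fun (W W' : FinSub k V) h => (bangTrans W W' h).toLinearMap) H

/-- The coproduct and counit of `!V` are induced out of the direct limit by those of the `!W`. -/
instance : CoalgebraStruct k (Bang k V) where
  comul := Bang.desc k
    (fun W => TensorProduct.map (Bang.of k W) (Bang.of k W) ∘ₗ Coalgebra.comul)
    (fun W W' h => by
      rw [LinearMap.comp_assoc, ← (bangTrans W W' h).map_comp_comul, ← LinearMap.comp_assoc,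
        ← TensorProduct.map_comp, Bang.of_trans])
  counit := Bang.desc k (fun _ => Coalgebra.counit) (fun W W' h => (bangTrans W W' h).counit_comp)

lemma Bang.comul_comp_of (W : FinSub k V) :
    Coalgebra.comul (R := k) ∘ₗ Bang.of k W =
      TensorProduct.map (Bang.of k W) (Bang.of k W) ∘ₗ Coalgebra.comul (R := k) :=
  Bang.desc_comp_of k _ _ W

lemma Bang.counit_comp_of (W : FinSub k V) :
    Coalgebra.counit (R := k) ∘ₗ Bang.of k W = Coalgebra.counit (R := k) :=
  Bang.desc_comp_of k _ _ W

instance : Coalgebra k (Bang k V) where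
  coassoc := Bang.hom_ext k fun W =>
    coassoc_comp_of_comul (Bang.of k W) (Bang.comul_comp_of k W)
  rTensor_counit_comp_comul := Bang.hom_ext k fun W =>
    rTensor_comp_of_comul (Bang.of k W) (Bang.comul_comp_of k W) (Bang.counit_comp_of k W)
  lTensor_counit_comp_comul := Bang.hom_ext k fun W =>
    lTensor_comp_of_comul (Bang.of k W) (Bang.comul_comp_of k W) (Bang.counit_comp_of k W)

variable (V) in
/-- The dereliction `d : !V → V`, induced out of the direct limit by the derelictions
`!W → W ⊆ V`. -/
def dereliction : Bang k V →ₗ[k] V :=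
  Bang.desc k (fun W => W.1.subtype ∘ₗ derelictionFin k W.1) (fun W W' h => by
    rw [LinearMap.comp_assoc, bangTrans, derelictionFin_comp_bangFinMap, ← LinearMap.comp_assoc,
      Submodule.subtype_comp_inclusion])

end Colimit

end CofreeCoalgebra

end

/-! The proof embeds everything into the dual of `R = Sym(V^*)`. If `C` is cocommutative, its dual
is a commutative algebra under convolution, so `l ↦ l ∘ φ` extends to an algebra map `R → C^*`, with
adjoint `toDual φ : C → R^*`. This construction is natural in coalgebra morphisms, and its linear
forms recover `φ`.

Two facts about `d : !V → V` therefore suffice. If `toDual d` is injective, a morphism into `!V` is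
determined by its composite with `d` (`coalgHom_ext_of_injective`). If its image also contains every
`toDual φ c`, the linear map `(toDual d)⁻¹ ∘ toDual φ` is a morphism of coalgebras lifting `φ`
(`exists_coalgHom_of_range_le`): compatibility with the coproduct is tested against products `f *
g`, because the pairing separates points of the tensor square too (`tensor_eq_zero_of_pairing`).

For finite-dimensional `V`, the summand at `P` is a copy of `Sym(V)` on which `z_i` acts as
`∂/∂e_i`. Hence `z^b` pairs with `s` to give `b!` times the coefficient of `e^b` in `s`. Since
factorials are invertible, this identifies the summand with the functionals killed by a power of
each `z_i`, a simultaneous generalised eigenspace of the commuting operators `x_i` on `R^*`.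
Eigenspaces at different `P` are independent, which gives injectivity. A functional `toDual φ c`
generates a finite-dimensional `R`-module, because `Δ c` is a finite sum; over an algebraically
closed field this module splits into such eigenspaces (`mem_iSup_pointSpace`), which gives the
image.

For general `V`, both facts descend to a finite-dimensional `W ⊆ V`: an element of `!V` comes from
some `!W`, and `toDual φ c` depends only on the finitely many left factors of `Δ c`
(`toDual_comp_eq_of_repr`). -/

noncomputable section

namespace CofreeCoalgebra

universe u v w

/-! ### The pairing of polynomial functions with a coalgebra, and the criterion for universality. -/

section Pairing

open WithConv

variable {k : Type u} {V : Type v} {C : Type w} [Field k] [AddCommGroup V] [Module k V]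
  [AddCommGroup C] [Module k C] [Coalgebra k C] [Coalgebra.IsCocomm k C]

/-- The morphism from polynomial functions on `V` to the convolution algebra of `C` that extends
`l ↦ l ∘ φ` on `V^*`. -/
def convHom (φ : C →ₗ[k] V) : PolyRing k V →ₐ[k] WithConv (C →ₗ[k] k) :=
  SymmetricAlgebra.lift
    { toFun := fun l => toConv (l ∘ₗ φ)
      map_add' := fun _ _ => rfl
      map_smul' := fun _ _ => rfl }

/-- The pairing of polynomial functions on `V` with a cocommutative coalgebra `C` over `V`. -/
def pairing (φ : C →ₗ[k] V) : PolyRing k V →ₗ[k] C →ₗ[k] k where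
  toFun f := (convHom φ f).ofConv
  map_add' f g := by rw [map_add]; rfl
  map_smul' r f := by rw [map_smul]; rfl

lemma pairing_ι (φ : C →ₗ[k] V) (l : Module.Dual k V) :
    pairing φ (SymmetricAlgebra.ι k _ l) = l ∘ₗ φ :=
  congrArg ofConv (SymmetricAlgebra.lift_ι_apply _ l)

lemma pairing_algebraMap (φ : C →ₗ[k] V) (r : k) :
    pairing φ (algebraMap k _ r) = r • Coalgebra.counit (R := k) := by
  change (convHom φ (algebraMap k _ r)).ofConv = _
  rw [AlgHom.commutes]
  rfl

lemma pairing_one (φ : C →ₗ[k] V) : pairing φ 1 = Coalgebra.counit (R := k) := by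
  rw [← map_one (algebraMap k _), pairing_algebraMap, one_smul]

lemma pairing_mul (φ : C →ₗ[k] V) (f g : PolyRing k V) :
    pairing φ (f * g) = LinearMap.mul' k k ∘ₗ TensorProduct.map (pairing φ f) (pairing φ g) ∘ₗ
      Coalgebra.comul (R := k) := by
  change (convHom φ (f * g)).ofConv = _
  rw [map_mul]
  rfl

lemma pairing_mul_repr (φ : C →ₗ[k] V) (f g : PolyRing k V) {c : C} {ι : Type*}
    (r : Coalgebra.Repr k c ι) :
    pairing φ (f * g) c = ∑ i ∈ r.index, pairing φ f (r.left i) * pairing φ g (r.right i) := by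
  rw [pairing_mul, LinearMap.comp_apply, LinearMap.comp_apply, ← r.eq]
  simp

/-- Convolution is built from the counit and coproduct alone, which `Φ` preserves, so it is enough
to compare on linear forms. -/
lemma pairing_comp {D : Type*} [AddCommGroup D] [Module k D] [Coalgebra k D]
    [Coalgebra.IsCocomm k D] (φ : C →ₗ[k] V) (Φ : D →ₗc[k] C) (f : PolyRing k V) :
    pairing (φ ∘ₗ Φ.toLinearMap) f = pairing φ f ∘ₗ Φ.toLinearMap := by
  induction f using SymmetricAlgebra.induction with
  | algebraMap r =>
    rw [pairing_algebraMap, pairing_algebraMap, LinearMap.smul_comp]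
    congr 1
    exact Φ.counit_comp.symm
  | ι l => rw [pairing_ι, pairing_ι, LinearMap.comp_assoc]
  | mul f g hf hg =>
    rw [pairing_mul, pairing_mul, hf, hg, TensorProduct.map_comp, LinearMap.comp_assoc,
      LinearMap.comp_assoc, LinearMap.comp_assoc]
    congr 2
    exact Φ.map_comp_comul
  | add f g hf hg => rw [map_add, map_add, hf, hg, LinearMap.add_comp]

lemma pairing_linear_comp {W : Type v} [AddCommGroup W] [Module k W] (ρ : V →ₗ[k] W)
    (φ : C →ₗ[k] V) (f : PolyRing k W) :
    pairing (ρ ∘ₗ φ) f = pairing φ (symMap ρ.dualMap f) := by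
  induction f using SymmetricAlgebra.induction with
  | algebraMap r => rw [AlgHom.commutes, pairing_algebraMap, pairing_algebraMap]
  | ι l => rw [symMap_ι, pairing_ι, pairing_ι]; rfl
  | mul f g hf hg => rw [map_mul (symMap _), pairing_mul, pairing_mul, hf, hg]
  | add f g hf hg => rw [map_add, map_add, map_add, hf, hg]

/-- The linear map `C → Sym(V^*)^*` adjoint to the pairing. -/
def toDual (φ : C →ₗ[k] V) : C →ₗ[k] Module.Dual k (PolyRing k V) := (pairing φ).flip

lemma toDual_apply (φ : C →ₗ[k] V) (c : C) (f : PolyRing k V) : toDual φ c f = pairing φ f c := rfl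

lemma toDual_comp {D : Type*} [AddCommGroup D] [Module k D] [Coalgebra k D]
    [Coalgebra.IsCocomm k D] (φ : C →ₗ[k] V) (Φ : D →ₗc[k] C) :
    toDual (φ ∘ₗ Φ.toLinearMap) = toDual φ ∘ₗ Φ.toLinearMap :=
  LinearMap.ext fun c => LinearMap.ext fun f => LinearMap.congr_fun (pairing_comp φ Φ f) c

/-- Write `x = ∑ c_i ⊗ b_i` in a basis `b` of the right factor. Contracting the left factor with `f`
gives an element of `C` killed by every `g`, hence zero. So each `c_i` is killed by every `f`, hence
zero as well. -/
lemma tensor_eq_zero_of_pairing {d : C →ₗ[k] V} (hd : Function.Injective (toDual d)) (x : C ⊗[k] C)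
    (h : ∀ f g, LinearMap.mul' k k (TensorProduct.map (pairing d f) (pairing d g) x) = 0) :
    x = 0 := by
  let b := Module.Basis.ofVectorSpace k C
  obtain ⟨s, rfl⟩ := TensorProduct.eq_repr_basis_right b x
  suffices s = 0 by rw [this, Finsupp.sum_zero_index]
  ext i
  refine hd ?_
  rw [Finsupp.zero_apply, map_zero]
  refine LinearMap.ext fun f => ?_
  rw [toDual_apply, LinearMap.zero_apply]
  have h1 : s.sum (fun i c => pairing d f c • b i) = 0 := by
    refine hd ?_
    rw [map_zero]
    refine LinearMap.ext fun g => ?_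
    have := h f g
    simp only [Finsupp.sum, map_sum, TensorProduct.map_tmul, LinearMap.mul'_apply] at this
    simpa [Finsupp.sum, toDual_apply] using this
  have h2 := DFunLike.congr_fun (congrArg b.repr h1) i
  rw [Finsupp.sum, map_sum, Finsupp.finsetSum_apply, Finset.sum_eq_single i] at h2
  · simpa using h2
  · intro j _ hj
    rw [map_smul, Module.Basis.repr_self, Finsupp.smul_apply, Finsupp.single_eq_of_ne hj.symm,
      smul_zero]
  · intro hi
    rw [Finsupp.notMem_support_iff.1 hi, map_zero, zero_smul, map_zero, Finsupp.zero_apply]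

/-- If the pairing separates the points of `B`, a morphism of coalgebras into `B` is determined by
its composite with `d : B → V`. -/
lemma coalgHom_ext_of_injective {B : Type*} [AddCommGroup B] [Module k B] [Coalgebra k B]
    [Coalgebra.IsCocomm k B] {d : B →ₗ[k] V} (hd : Function.Injective (toDual d))
    {Φ Ψ : C →ₗc[k] B} (h : d ∘ₗ Φ.toLinearMap = d ∘ₗ Ψ.toLinearMap) : Φ = Ψ := by
  have h1 : toDual d ∘ₗ Φ.toLinearMap = toDual d ∘ₗ Ψ.toLinearMap := by
    rw [← toDual_comp, h, toDual_comp]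
  exact CoalgHom.ext fun c => hd (LinearMap.congr_fun h1 c)

/-- If the pairing separates the points of `B`, a linear map `φ : C → V` lifts to a morphism of
coalgebras `C → B` as soon as the functionals on `Sym(V^*)` it defines all come from `B`. -/
lemma exists_coalgHom_of_range_le {B : Type*} [AddCommGroup B] [Module k B] [Coalgebra k B]
    [Coalgebra.IsCocomm k B] {d : B →ₗ[k] V} (hd : Function.Injective (toDual d))
    {φ : C →ₗ[k] V} (h : ∀ c, toDual φ c ∈ LinearMap.range (toDual d)) :
    ∃ Φ : C →ₗc[k] B, d ∘ₗ Φ.toLinearMap = φ := by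
  let Φ : C →ₗ[k] B := (LinearEquiv.ofInjective (toDual d) hd).symm.toLinearMap ∘ₗ
    (toDual φ).codRestrict _ h
  have hΦ : ∀ c, toDual d (Φ c) = toDual φ c := fun c =>
    congrArg Subtype.val ((LinearEquiv.ofInjective (toDual d) hd).apply_symm_apply ⟨_, h c⟩)
  have hp : ∀ f, pairing d f ∘ₗ Φ = pairing φ f := fun f =>
    LinearMap.ext fun c => LinearMap.congr_fun (hΦ c) f
  refine ⟨{ Φ with counit_comp := ?_, map_comp_comul := ?_ }, ?_⟩
  · rw [← pairing_one d, hp, pairing_one]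
  · change TensorProduct.map Φ Φ ∘ₗ Coalgebra.comul (R := k) = Coalgebra.comul (R := k) ∘ₗ Φ
    -- Paired with `f ⊗ g`, both sides give the value of `f * g` at `c`, since products of
    -- polynomials are computed through the coproducts.
    refine LinearMap.ext fun c => sub_eq_zero.1 (tensor_eq_zero_of_pairing hd _ fun f g => ?_)
    have h1 := LinearMap.congr_fun (pairing_mul φ f g) c
    have h2 := LinearMap.congr_fun (pairing_mul d f g) (Φ c)
    rw [← hp (f * g), ← hp f, ← hp g, TensorProduct.map_comp] at h1
    rw [map_sub, map_sub, sub_eq_zero]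
    exact h1.symm.trans h2
  · change d ∘ₗ Φ = φ
    -- Linear functionals separate the points of `V`, and they are the degree one part of the
    -- pairing.
    refine LinearMap.ext fun c => (Module.forall_dual_apply_eq_zero_iff k _).1 ?_ |> sub_eq_zero.1
    intro l
    have := LinearMap.congr_fun (hp (SymmetricAlgebra.ι k _ l)) c
    rw [pairing_ι, pairing_ι] at this
    rw [map_sub, sub_eq_zero]
    exact this

end Pairing

/-! ### Cocommutativity of `!V`. -/

section Cocomm

variable (k : Type u) [Field k]

/-- Cocommutativity of `A` gives that of `B` on the image of `g`. The kets, and then the canonical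
maps `!W → !V`, are jointly surjective, so this settles both instances below. -/
lemma comm_comp_comul_comp {A B : Type*} [AddCommGroup A] [Module k A] [Coalgebra k A]
    [Coalgebra.IsCocomm k A] [AddCommGroup B] [Module k B] [CoalgebraStruct k B] (g : A →ₗ[k] B)
    (h : Coalgebra.comul (R := k) ∘ₗ g = TensorProduct.map g g ∘ₗ Coalgebra.comul (R := k)) :
    ((TensorProduct.comm k B B).toLinearMap ∘ₗ Coalgebra.comul (R := k)) ∘ₗ g =
      Coalgebra.comul (R := k) ∘ₗ g := by
  refine LinearMap.ext fun a => ?_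
  have h1 := LinearMap.congr_fun h a
  simp only [LinearMap.comp_apply] at h1
  simp only [LinearMap.comp_apply, h1, LinearEquiv.coe_coe]
  rw [← TensorProduct.map_comm, Coalgebra.comm_comul]

variable (V : Type v) [CharZero k] [AddCommGroup V] [Module k V]

instance [FiniteDimensional k V] : Coalgebra.IsCocomm k (BangFin k V) where
  comm_comp_comul := ket_hom_ext k fun P => comm_comp_comul_comp k _ (comul_comp_ket k P)

instance : Coalgebra.IsCocomm k (Bang k V) where
  comm_comp_comul := Bang.hom_ext k fun W => comm_comp_comul_comp k _ (Bang.comul_comp_of k W)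

end Cocomm

/-! ### The pairing on the summand at one point: `z_i` acts as `∂/∂e_i`. -/

section PointPairing

variable (k : Type u) {V : Type v} [Field k] [AddCommGroup V] [Module k V] [FiniteDimensional k V]

/-- The restriction of the dereliction to the summand of `!V` at `P`, as a map out of `Sym(V)`. -/
def pointDereliction (P : V) : SymmetricAlgebra k V →ₗ[k] V :=
  (Coalgebra.counit (R := k)).smulRight P + degOne k V

/-- The derivation `∂/∂e_i` of `Sym(V)`. -/
def symDer (i : Fin (dim k V)) : SymmetricAlgebra k V →ₗ[k] SymmetricAlgebra k V :=
  (symEquiv k V).symm.toLinearMap ∘ₗ (MvPolynomial.pderiv i).toLinearMap ∘ₗ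
    (symEquiv k V).toLinearMap

lemma symEquiv_symDer (i : Fin (dim k V)) (s : SymmetricAlgebra k V) :
    symEquiv k V (symDer k i s) = MvPolynomial.pderiv i (symEquiv k V s) := by
  simp [symDer]

/-- The coefficient of `e_i` in an element of `Sym(V)`. -/
def degOneCoord (i : Fin (dim k V)) : SymmetricAlgebra k V →ₗ[k] k :=
  (stdBasis k V).coord i ∘ₗ degOne k V

lemma degOneCoord_mul (i : Fin (dim k V)) (s t : SymmetricAlgebra k V) :
    degOneCoord k i (s * t) = Coalgebra.counit (R := k) s * degOneCoord k i t +
      Coalgebra.counit (R := k) t * degOneCoord k i s := by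
  simp [degOneCoord, degOne_mul]

lemma symDer_mul (i : Fin (dim k V)) (s t : SymmetricAlgebra k V) :
    symDer k i (s * t) = s * symDer k i t + t * symDer k i s := by
  simp [symDer, Derivation.leibniz]

lemma symDer_ι (i : Fin (dim k V)) (v : V) :
    symDer k i (SymmetricAlgebra.ι k V v) = algebraMap k _ ((stdBasis k V).coord i v) := by
  suffices symDer k i ∘ₗ SymmetricAlgebra.ι k V =
      Algebra.linearMap k _ ∘ₗ (stdBasis k V).coord i from LinearMap.congr_fun this v
  refine (stdBasis k V).ext fun j => (symEquiv k V).injective ?_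
  rw [LinearMap.comp_apply, symEquiv_symDer, ← symEquiv_symm_X, AlgEquiv.apply_symm_apply,
    MvPolynomial.pderiv_X]
  by_cases h : j = i
  · subst h; simp
  · simp [h, Ne.symm h]

/-- Both sides are derivations of `Sym(V)` with the same values on `V`. The left side is one because
`Δ` is multiplicative and `degOneCoord` is a derivation relative to the counit. -/
lemma lid_map_degOneCoord_comul (i : Fin (dim k V)) (s : SymmetricAlgebra k V) :
    TensorProduct.lid k _ ((degOneCoord k i).rTensor _ (Coalgebra.comul (R := k) s)) =
      symDer k i s := by
  have key : ∀ x y : SymmetricAlgebra k V ⊗[k] SymmetricAlgebra k V,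
      TensorProduct.lid k _ ((degOneCoord k i).rTensor _ (x * y)) =
      TensorProduct.lid k _ ((Coalgebra.counit (R := k)).rTensor _ x) *
        TensorProduct.lid k _ ((degOneCoord k i).rTensor _ y) +
      TensorProduct.lid k _ ((Coalgebra.counit (R := k)).rTensor _ y) *
        TensorProduct.lid k _ ((degOneCoord k i).rTensor _ x) := by
    intro x y
    induction x with
    | zero => simp
    | add x x' hx hx' => simp only [add_mul, mul_add, map_add, hx, hx']; ring
    | tmul a b =>
      induction y with
      | zero => simp
      | add y y' hy hy' => simp only [add_mul, mul_add, map_add, hy, hy']; ring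
      | tmul a' b' =>
        simp only [Algebra.TensorProduct.tmul_mul_tmul, LinearMap.rTensor_tmul,
          TensorProduct.lid_tmul, degOneCoord_mul, Algebra.smul_def, map_add, map_mul]
        ring
  induction s using SymmetricAlgebra.induction with
  | algebraMap r =>
    simp [degOneCoord, symDer, Algebra.TensorProduct.algebraMap_apply, degOne_algebraMap,
      MvPolynomial.algebraMap_eq]
  | ι v =>
    have : degOne k V 1 = 0 := by simpa using degOne_algebraMap (V := V) k 1
    simp [symDer_ι, degOneCoord, degOne_ι, this, Algebra.smul_def]
  | mul s t hs ht =>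
    rw [Bialgebra.comul_mul, key, hs, ht, symDer_mul, Coalgebra.rTensor_counit_comul,
      Coalgebra.rTensor_counit_comul]
    simp
  | add s t hs ht => simp only [map_add, hs, ht]

/-- Passing from `x_i` to `z_i` subtracts exactly the counit term of `pointDereliction`. -/
lemma pairing_localCoord (P : V) (i : Fin (dim k V)) :
    pairing (pointDereliction k P) (localCoord k P i) = degOneCoord k i := by
  rw [localCoord, map_sub, pairing_algebraMap, coordFun, pairing_ι]
  refine LinearMap.ext fun s => ?_
  simp [pointDereliction, degOneCoord, mul_comm]

/-- The transpose of multiplication by `z_i` is contraction of one factor of the coproduct with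
`degOneCoord k i`, that is, `∂/∂e_i`. -/
lemma pairing_localCoord_mul (P : V) (i : Fin (dim k V)) (f : PolyRing k V)
    (s : SymmetricAlgebra k V) :
    pairing (pointDereliction k P) (localCoord k P i * f) s =
      pairing (pointDereliction k P) f (symDer k i s) := by
  rw [pairing_mul, pairing_localCoord, ← lid_map_degOneCoord_comul, LinearMap.comp_apply,
    LinearMap.comp_apply]
  induction Coalgebra.comul (R := k) s with
  | zero => simp
  | add x y hx hy => simp only [map_add, hx, hy]
  | tmul a b => simp

lemma pairing_localCoord_pow_mul (P : V) (i : Fin (dim k V)) (N : ℕ) (f : PolyRing k V)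
    (s : SymmetricAlgebra k V) :
    pairing (pointDereliction k P) (localCoord k P i ^ N * f) s =
      pairing (pointDereliction k P) f ((symDer k i ^ N) s) := by
  induction N generalizing s with
  | zero => simp
  | succ N ih => rw [pow_succ', mul_assoc, pairing_localCoord_mul, ih, pow_succ]; rfl

lemma symDer_pow_eq_zero (i : Fin (dim k V)) (N : ℕ) (s : SymmetricAlgebra k V)
    (h : ∀ m, N ≤ m i → MvPolynomial.coeff m (symEquiv k V s) = 0) : (symDer k i ^ N) s = 0 := by
  induction N generalizing s with
  | zero =>
    refine (symEquiv k V).injective (MvPolynomial.ext _ _ fun m => ?_)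
    simpa using h m (Nat.zero_le _)
  | succ N ih =>
    rw [pow_succ]
    refine ih _ fun m hm => ?_
    rw [symEquiv_symDer, MvPolynomial.coeff_pderiv, h, zero_mul]
    simpa using hm

lemma exists_symDer_pow_eq_zero (i : Fin (dim k V)) (s : SymmetricAlgebra k V) :
    ∃ N, (symDer k i ^ N) s = 0 := by
  -- One derivative more than the degree of `s` in `e_i`.
  refine ⟨(symEquiv k V s).degreeOf i + 1, symDer_pow_eq_zero k i _ s fun m hm => ?_⟩
  by_contra h
  have := MvPolynomial.monomial_le_degreeOf i (MvPolynomial.mem_support_iff.2 h)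
  omega

/-- The monomial `z_1^(b_1) ⋯ z_n^(b_n)` in the local coordinates at `P`. -/
def localMonomial (P : V) (b : Fin (dim k V) →₀ ℕ) : PolyRing k V :=
  (taylor k P).symm (MvPolynomial.monomial b 1)

/-- Moving all the `z_i` across turns the pairing into the constant term of `∂^b s`, by Taylor's
formula `b!` times a coefficient. -/
lemma pairing_localMonomial (P : V) (b : Fin (dim k V) →₀ ℕ) (s : SymmetricAlgebra k V) :
    pairing (pointDereliction k P) (localMonomial k P b) s =
      (∏ i, ((b i).factorial : k)) * MvPolynomial.coeff b (symEquiv k V s) := by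
  -- The formula is propagated from `c` to `b + c`. In this form it is closed under addition in `b`,
  -- so only exponents in a single variable remain. The case `c = 0` is the counit.
  suffices ∀ c : Fin (dim k V) →₀ ℕ, (∀ s, pairing (pointDereliction k P) (localMonomial k P c) s =
      (∏ i, ((c i).factorial : k)) * MvPolynomial.coeff c (symEquiv k V s)) →
      ∀ s, pairing (pointDereliction k P) (localMonomial k P (b + c)) s =
        (∏ i, (((b + c) i).factorial : k)) * MvPolynomial.coeff (b + c) (symEquiv k V s) by
    have h0 := this 0 (fun s => by
      have h1 : localMonomial k P 0 = 1 := map_one (taylor k P).symm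
      rw [h1, pairing_one, counit_eq_coeff]
      simp) s
    rwa [add_zero] at h0
  clear s
  induction b using Finsupp.induction_linear with
  | zero => intro c hc; rwa [zero_add]
  | add a b ha hb => intro c hc; rw [add_assoc]; exact ha _ (hb _ hc)
  | single i N =>
    intro c hc
    induction N with
    | zero => rwa [Finsupp.single_zero, zero_add]
    | succ N ih =>
      intro s
      have h1 : Finsupp.single i (N + 1) + c = Finsupp.single i N + c + Finsupp.single i 1 := by
        rw [Finsupp.single_add]; abel
      rw [h1]
      generalize Finsupp.single i N + c = a at ih
      have h2 : localMonomial k P (a + Finsupp.single i 1) =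
          localCoord k P i * localMonomial k P a := by
        rw [← taylor_symm_X, localMonomial, localMonomial, ← map_mul, MvPolynomial.X,
          MvPolynomial.monomial_mul, one_mul, add_comm]
      have h3 : ∏ j, (((a + Finsupp.single i 1 : Fin (dim k V) →₀ ℕ) j).factorial : k) =
          (∏ j, ((a j).factorial : k)) * (a i + 1) := by
        rw [← Finset.mul_prod_erase Finset.univ _ (Finset.mem_univ i),
          ← Finset.mul_prod_erase Finset.univ (fun j => ((a j).factorial : k)) (Finset.mem_univ i),
          Finset.prod_congr rfl (g := fun j => ((a j).factorial : k)) (fun j hj => by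
            rw [Finsupp.add_apply, Finsupp.single_eq_of_ne (Finset.ne_of_mem_erase hj), add_zero]),
          Finsupp.add_apply, Finsupp.single_eq_same, Nat.factorial_succ]
        push_cast
        ring
      rw [h2, pairing_localCoord_mul, ih, symEquiv_symDer, MvPolynomial.coeff_pderiv, h3]
      ring

lemma poly_hom_ext (P : V) {M : Type*} [AddCommGroup M] [Module k M] {g h : PolyRing k V →ₗ[k] M}
    (H : ∀ b, g (localMonomial k P b) = h (localMonomial k P b)) : g = h := by
  have : g ∘ₗ (taylor k P).symm.toLinearMap = h ∘ₗ (taylor k P).symm.toLinearMap :=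
    MvPolynomial.linearMap_ext fun b => LinearMap.ext_ring (H b)
  exact (LinearMap.cancel_right (taylor k P).symm.surjective).1 this

end PointPairing

/-! ### Functionals supported at points, as simultaneous generalised eigenspaces. -/

section PointSpaces

variable (k : Type u) {V : Type v} [Field k] [AddCommGroup V] [Module k V]

/-- The action of `R = Sym(V^*)` on its dual space, by transposed multiplication. -/
def dualMul : PolyRing k V →ₐ[k] Module.End k (Module.Dual k (PolyRing k V)) :=
  AlgHom.ofLinearMap
    { toFun := fun g => (LinearMap.mulLeft k g).dualMap
      map_add' := fun f g => LinearMap.ext fun θ => LinearMap.ext fun h => by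
        simp [add_mul]
      map_smul' := fun r g => LinearMap.ext fun θ => LinearMap.ext fun h => by
        simp }
    (LinearMap.ext fun θ => LinearMap.ext fun h => by simp)
    (fun f g => LinearMap.ext fun θ => LinearMap.ext fun h => by
      simp [mul_left_comm f g])

lemma dualMul_apply (g f : PolyRing k V) (θ : Module.Dual k (PolyRing k V)) :
    dualMul k g θ f = θ (g * f) := rfl

lemma mapsTo_maxGenEigenspace_dualMul (f g : PolyRing k V) (μ : k) :
    Set.MapsTo (dualMul k f) ((dualMul k g).maxGenEigenspace μ)
      ((dualMul k g).maxGenEigenspace μ) :=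
  Module.End.mapsTo_maxGenEigenspace_of_comm ((Commute.all g f).map (dualMul k)) μ

variable [FiniteDimensional k V]

/-- The functionals on `R` supported at the point `P`. -/
def pointSpace (P : V) : Submodule k (Module.Dual k (PolyRing k V)) :=
  ⨅ i, (dualMul k (coordFun k V i)).maxGenEigenspace ((stdBasis k V).coord i P)

/-- The operator `x_i - P_i` on functionals is the action of `z_i`. -/
lemma mem_pointSpace {P : V} {θ : Module.Dual k (PolyRing k V)} :
    θ ∈ pointSpace k P ↔ ∀ i, ∃ N : ℕ, ∀ f, θ (localCoord k P i ^ N * f) = 0 := by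
  rw [pointSpace, Module.End.mem_iInf_maxGenEigenspace_iff]
  refine forall_congr' fun i => exists_congr fun N => ?_
  have : dualMul k (coordFun k V i) - (stdBasis k V).coord i P • 1 =
      dualMul k (localCoord k P i) := by
    rw [localCoord, map_sub, AlgHom.commutes, Algebra.algebraMap_eq_smul_one]
  rw [this, ← map_pow, LinearMap.ext_iff]
  rfl

/-- The `x_i` commute, so their simultaneous generalised eigenspaces for distinct eigenvalue tuples
are independent, and distinct points have distinct coordinate tuples. -/
lemma iSupIndep_pointSpace : iSupIndep (pointSpace k (V := V)) :=
  (Module.End.independent_iInf_maxGenEigenspace_of_forall_mapsTo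
    (fun i => dualMul k (coordFun k V i))
    fun _ _ μ => mapsTo_maxGenEigenspace_dualMul k _ _ μ).comp
    (f := fun P i => (stdBasis k V).coord i P) fun _ _ h =>
      (stdBasis k V).ext_elem fun i => congrFun h i

/-- A functional that generates a finite-dimensional `R`-submodule is a sum of functionals
supported at points. -/
lemma mem_iSup_pointSpace [IsAlgClosed k] (θ : Module.Dual k (PolyRing k V))
    (hθ : FiniteDimensional k (Submodule.span k (Set.range fun g => dualMul k g θ))) :
    θ ∈ ⨆ P, pointSpace k (V := V) P := by
  set M := Submodule.span k (Set.range fun g => dualMul k g θ) with hM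
  have hT : ∀ i, Set.MapsTo (dualMul k (coordFun k V i)) M M := by
    intro i
    change M ≤ M.comap (dualMul k (coordFun k V i))
    rw [hM, Submodule.span_le]
    rintro _ ⟨g, rfl⟩
    refine Submodule.subset_span ⟨coordFun k V i * g, ?_⟩
    change dualMul k _ θ = _
    rw [map_mul]
    rfl
  have hθM : θ ∈ M := Submodule.subset_span ⟨1, by simp⟩
  have hcomm : ∀ i j, Commute ((dualMul k (coordFun k V i)).restrict (hT i))
      ((dualMul k (coordFun k V j)).restrict (hT j)) := fun i j =>
    LinearMap.restrict_commute ((Commute.all _ _).map (dualMul k)) (hT i) (hT j)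
  -- Over an algebraically closed field each `x_i` acts on the finite-dimensional `M` with
  -- generalised eigenspaces spanning `M`. As the `x_i` commute, so do the simultaneous ones.
  have htop :=
    Module.End.iSup_iInf_maxGenEigenspace_eq_top_of_iSup_maxGenEigenspace_eq_top_of_commute
    (M := M) (fun i => (dualMul k (coordFun k V i)).restrict (hT i))
    (fun i j _ => hcomm i j)
    (fun i => Module.End.iSup_maxGenEigenspace_eq_top _)
  have h1 : θ ∈ Submodule.map M.subtype ⊤ := ⟨⟨θ, hθM⟩, trivial, rfl⟩
  rw [← htop, Submodule.map_iSup] at h1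
  refine (iSup_le fun χ => ?_ : _ ≤ ⨆ P, pointSpace k (V := V) P) h1
  -- The eigenspaces inside `M` are the intersections of `M` with those in the whole dual.
  rw [← Submodule.inf_iInf_maxGenEigenspace_of_forall_mapsTo]
  refine inf_le_right.trans ?_
  -- The tuple `χ` of eigenvalues is the coordinate vector of the supporting point.
  refine le_iSup_of_le ((stdBasis k V).equivFun.symm χ) (le_of_eq ?_)
  rw [pointSpace]
  refine iInf_congr fun i => ?_
  rw [Module.Basis.coord_apply, ← Module.Basis.equivFun_apply, LinearEquiv.apply_symm_apply]

end PointSpaces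

/-! ### Injectivity and image of `toDual` for finite-dimensional spaces. -/

section FinDim

variable (k : Type u) {V : Type v} [Field k] [CharZero k] [AddCommGroup V] [Module k V]
  [FiniteDimensional k V]

/-- The map `ket k P` is a morphism of coalgebras whose composite with the dereliction is
`pointDereliction k P`, so naturality of `toDual` applies. -/
lemma toDual_ket (P : V) (s : SymmetricAlgebra k V) :
    toDual (derelictionFin k V) (ket k P s) = toDual (pointDereliction k P) s := by
  let Φ : SymmetricAlgebra k V →ₗc[k] BangFin k V :=
    { ket k P with
      counit_comp := counit_comp_ket k P
      map_comp_comul := (comul_comp_ket k P).symm }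
  have h : derelictionFin k V ∘ₗ Φ.toLinearMap = pointDereliction k P :=
    LinearMap.ext fun s => derelictionFin_ket k P s
  rw [← h, toDual_comp]
  rfl

omit [CharZero k] in
lemma toDual_pointDereliction_mem (P : V) (s : SymmetricAlgebra k V) :
    toDual (pointDereliction k P) s ∈ pointSpace k P := by
  rw [mem_pointSpace]
  intro i
  obtain ⟨N, hN⟩ := exists_symDer_pow_eq_zero k i s
  exact ⟨N, fun f => by rw [toDual_apply, pairing_localCoord_pow_mul, hN, map_zero]⟩

lemma prod_factorial_ne_zero {n : ℕ} (b : Fin n →₀ ℕ) : ∏ i, ((b i).factorial : k) ≠ 0 :=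
  (factorialUnit k b).ne_zero

lemma toDual_pointDereliction_injective (P : V) :
    Function.Injective (toDual (pointDereliction k P)) := by
  rw [injective_iff_map_eq_zero]
  intro s hs
  refine (symEquiv k V).injective (MvPolynomial.ext _ _ fun b => ?_)
  have h := LinearMap.congr_fun hs (localMonomial k P b)
  rw [toDual_apply, pairing_localMonomial, LinearMap.zero_apply] at h
  rw [(mul_eq_zero.1 h).resolve_left (prod_factorial_ne_zero k b)]
  simp

/-- Each summand embeds into the functionals supported at its own point, and these subspaces are
independent. -/
lemma toDual_derelictionFin_injective : Function.Injective (toDual (derelictionFin k V)) := by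
  classical
  let G : ∀ P : V, LC k P →ₗ[k] pointSpace k P := fun P =>
    (toDual (pointDereliction k P) ∘ₗ (fock k P).symm.toLinearMap).codRestrict _
      fun η => toDual_pointDereliction_mem k P _
  have h : toDual (derelictionFin k V) =
      DFinsupp.lsum k (fun P => (pointSpace k P).subtype) ∘ₗ DFinsupp.mapRange.linearMap G := by
    refine BangFin.hom_ext k fun P => LinearMap.ext fun η => ?_
    obtain ⟨s, rfl⟩ := (fock k P).surjective η
    refine (toDual_ket k P s).trans ?_
    change _ = DFinsupp.lsum k (fun P => (pointSpace k P).subtype)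
      (DFinsupp.mapRange.linearMap G (DFinsupp.single P (fock k P s)))
    rw [DFinsupp.mapRange.linearMap_apply, DFinsupp.mapRange_single, DFinsupp.lsum_single]
    simp [G]
  have hG : Function.Injective (DFinsupp.mapRange.linearMap G) := by
    refine (DFinsupp.mapRange_injective (fun P => G P) fun P => map_zero (G P)).2 fun P => ?_
    intro η η' hη
    exact (fock k P).symm.injective
      (toDual_pointDereliction_injective k P (congrArg Subtype.val hη))
  have hsum : Function.Injective (DFinsupp.lsum k fun P => (pointSpace k (V := V) P).subtype) :=
    (iSupIndep_pointSpace k).dfinsupp_lsum_injective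
  rw [h]
  exact hsum.comp hG

/-- A functional killed by powers of all the `z_i` is nonzero on only finitely many monomials `z^b`.
Dividing these values by `b!` gives the coefficients of a preimage. -/
lemma pointSpace_le_range (P : V) :
    pointSpace k P ≤ LinearMap.range (toDual (pointDereliction k P)) := by
  intro θ hθ
  rw [mem_pointSpace] at hθ
  choose N hN using hθ
  let s : SymmetricAlgebra k V := (symEquiv k V).symm
    (∑ b ∈ Finset.Iic (Finsupp.equivFunOnFinite.symm N),
      MvPolynomial.monomial b ((∏ i, ((b i).factorial : k))⁻¹ * θ (localMonomial k P b)))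
  refine ⟨s, poly_hom_ext k P fun b => ?_⟩
  rw [toDual_apply, pairing_localMonomial, AlgEquiv.apply_symm_apply, MvPolynomial.coeff_sum]
  simp only [MvPolynomial.coeff_monomial]
  rw [Finset.sum_ite_eq']
  split_ifs with hb
  · rw [mul_inv_cancel_left₀ (prod_factorial_ne_zero k b)]
  · rw [mul_zero]
    -- Outside the box the monomial is divisible by some `z_i ^ N i`, so `θ` kills it.
    obtain ⟨i, hi⟩ : ∃ i, N i < b i := by
      by_contra! h
      exact hb (Finset.mem_Iic.2 h)
    have h1 : localMonomial k P b =
        localCoord k P i ^ N i * localMonomial k P (b - Finsupp.single i (N i)) := by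
      rw [← taylor_symm_X, localMonomial, localMonomial, ← map_pow, ← map_mul,
        MvPolynomial.X_pow_eq_monomial, MvPolynomial.monomial_mul, one_mul,
        add_tsub_cancel_of_le (Finsupp.single_le_iff.2 hi.le)]
    rw [h1, hN]

lemma mem_range_toDual_derelictionFin [IsAlgClosed k] (θ : Module.Dual k (PolyRing k V))
    (hθ : FiniteDimensional k (Submodule.span k (Set.range fun g => dualMul k g θ))) :
    θ ∈ LinearMap.range (toDual (derelictionFin k V)) := by
  suffices ⨆ P, pointSpace k (V := V) P ≤ LinearMap.range (toDual (derelictionFin k V)) from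
    this (mem_iSup_pointSpace k θ hθ)
  refine iSup_le fun P => (pointSpace_le_range k P).trans ?_
  rintro _ ⟨s, rfl⟩
  exact ⟨ket k P s, toDual_ket k P s⟩

end FinDim

/-! ### Reduction of an arbitrary `V` to its finite-dimensional subspaces. -/

section Cofree

variable {k : Type u} {V : Type v} [Field k] [AddCommGroup V] [Module k V]

lemma symMap_surjective {W W' : Type v} [AddCommGroup W] [Module k W] [AddCommGroup W']
    [Module k W'] {ψ : W →ₗ[k] W'} (hψ : Function.Surjective ψ) :
    Function.Surjective (symMap ψ) := by
  intro s
  induction s using SymmetricAlgebra.induction with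
  | algebraMap r => exact ⟨algebraMap k _ r, AlgHom.commutes _ r⟩
  | ι w =>
    obtain ⟨v, rfl⟩ := hψ w
    exact ⟨SymmetricAlgebra.ι k _ v, symMap_ι ψ v⟩
  | mul a b ha hb =>
    obtain ⟨x, rfl⟩ := ha
    obtain ⟨y, rfl⟩ := hb
    exact ⟨x * y, map_mul _ x y⟩
  | add a b ha hb =>
    obtain ⟨x, rfl⟩ := ha
    obtain ⟨y, rfl⟩ := hb
    exact ⟨x + y, map_add _ x y⟩

section Dual

variable {C : Type w} [AddCommGroup C] [Module k C] [Coalgebra k C] [Coalgebra.IsCocomm k C]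

/-- If `Δ c = ∑ c'_i ⊗ c''_i`, then `g` carries the functional of `c` to `∑ ⟨g, c'_i⟩` times the
functional of `c''_i`. All translates thus lie in the span of finitely many functionals, independent
of `g`. -/
lemma finiteDimensional_span_dualMul_toDual (φ : C →ₗ[k] V) (c : C) :
    FiniteDimensional k (Submodule.span k (Set.range fun g => dualMul k g (toDual φ c))) := by
  let r := Coalgebra.Repr.arbitrary k c
  suffices Submodule.span k (Set.range fun g => dualMul k g (toDual φ c)) ≤
      Submodule.span k ((fun i => toDual φ (r.right i)) '' r.index) by
    have h := FiniteDimensional.span_of_finite k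
      (r.index.finite_toSet.image fun i => toDual φ (r.right i))
    exact Submodule.finiteDimensional_of_le this
  rw [Submodule.span_le]
  rintro _ ⟨g, rfl⟩
  have h : dualMul k g (toDual φ c) =
      ∑ i ∈ r.index, pairing φ g (r.left i) • toDual φ (r.right i) := by
    refine LinearMap.ext fun f => ?_
    rw [dualMul_apply, toDual_apply, pairing_mul_repr φ g f r]
    simp [toDual_apply]
  change dualMul k g (toDual φ c) ∈ _
  rw [h]
  exact Submodule.sum_mem _ fun i hi => Submodule.smul_mem _ _
    (Submodule.subset_span ⟨i, hi, rfl⟩)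

/-- The functional on `Sym(V^*)` given by an element `c` of a coalgebra over `V` only depends on the
restriction of polynomial functions to a subspace containing the image of the left tensor factors
of the coproduct of `c`. -/
lemma toDual_comp_eq_of_repr (φ : C →ₗ[k] V) (ρ : V →ₗ[k] V) (c : C) {ι : Type*}
    (r : Coalgebra.Repr k c ι) (hρ : ∀ i ∈ r.index, ρ (φ (r.left i)) = φ (r.left i)) :
    toDual (ρ ∘ₗ φ) c = toDual φ c := by
  -- The largest ideal in the kernel of the functional of `c`. Restriction along `ρ` is an algebra
  -- map, so it is the identity modulo `K` once it is so on linear forms.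
  let K : Ideal (PolyRing k V) :=
    { carrier := {f | ∀ g, pairing φ (f * g) c = 0}
      add_mem' := fun {a b} ha hb g => by
        rw [add_mul, map_add, LinearMap.add_apply, ha, hb, add_zero]
      zero_mem' := fun g => by rw [zero_mul, map_zero, LinearMap.zero_apply]
      smul_mem' := fun a f hf g => by
        rw [smul_eq_mul, mul_comm a, mul_assoc]
        exact hf _ }
  have h : (Ideal.Quotient.mkₐ k K).comp (symMap ρ.dualMap) = Ideal.Quotient.mkₐ k K := by
    refine SymmetricAlgebra.algHom_ext (LinearMap.ext fun l => ?_)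
    change Ideal.Quotient.mk K (symMap ρ.dualMap (SymmetricAlgebra.ι k _ l)) =
      Ideal.Quotient.mk K (SymmetricAlgebra.ι k _ l)
    rw [Ideal.Quotient.eq, symMap_ι, ← map_sub]
    intro g
    rw [pairing_mul_repr φ _ g r]
    refine Finset.sum_eq_zero fun i hi => ?_
    rw [pairing_ι, LinearMap.comp_apply, LinearMap.sub_apply, LinearMap.dualMap_apply, hρ i hi,
      sub_self, zero_mul]
  refine LinearMap.ext fun f => ?_
  have hf : symMap ρ.dualMap f - f ∈ K := Ideal.Quotient.eq.1 (AlgHom.congr_fun h f)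
  have := hf 1
  rw [mul_one, map_sub, LinearMap.sub_apply, sub_eq_zero] at this
  rw [toDual_apply, pairing_linear_comp, this, toDual_apply]

end Dual

variable [CharZero k]

lemma Bang.exists_of (x : Bang k V) : ∃ (W : FinSub k V) (y : BangFin k W.1), Bang.of k W y = x := by
  classical
  have : Nonempty (FinSub k V) := ⟨⟨⊥, inferInstance⟩⟩
  -- A sum of two finite-dimensional subspaces is finite-dimensional.
  have : IsDirectedOrder (FinSub k V) := ⟨fun W W' =>
    ⟨⟨W.1 ⊔ W'.1, inferInstance⟩, (le_sup_left : W.1 ≤ W.1 ⊔ W'.1),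
      (le_sup_right : W'.1 ≤ W.1 ⊔ W'.1)⟩⟩
  exact Module.DirectLimit.exists_of (R := k)
    (f := fun (W W' : FinSub k V) h => (bangTrans W W' h).toLinearMap) x

/-- An element coming from `!W` sees a polynomial function on `V` only through its restriction to
`W`. -/
lemma toDual_dereliction_of (W : FinSub k V) (y : BangFin k W.1) (f : PolyRing k V) :
    toDual (dereliction k V) (Bang.of k W y) f =
      toDual (derelictionFin k W.1) y (symMap W.1.subtype.dualMap f) := by
  let Φ : BangFin k W.1 →ₗc[k] Bang k V :=
    { Bang.of k W with
      counit_comp := Bang.counit_comp_of k W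
      map_comp_comul := (Bang.comul_comp_of k W).symm }
  have h : dereliction k V ∘ₗ Φ.toLinearMap = W.1.subtype ∘ₗ derelictionFin k W.1 :=
    Bang.desc_comp_of k _ _ W
  have h1 := LinearMap.congr_fun (toDual_comp (dereliction k V) Φ) y
  rw [h] at h1
  rw [toDual_apply (derelictionFin k W.1), ← pairing_linear_comp, ← toDual_apply, h1]
  rfl

/-- Linear forms on `W` extend to `V`, so every polynomial function on `W` is a restriction. An
element of `!W` killed by all restrictions vanishes by the finite-dimensional case. -/
lemma toDual_dereliction_injective : Function.Injective (toDual (dereliction k V)) := by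
  rw [injective_iff_map_eq_zero]
  intro x hx
  obtain ⟨W, y, rfl⟩ := Bang.exists_of x
  suffices y = 0 by rw [this, map_zero]
  refine toDual_derelictionFin_injective k ?_
  rw [map_zero]
  refine LinearMap.ext fun f => ?_
  obtain ⟨f, rfl⟩ := symMap_surjective
    (LinearMap.dualMap_surjective_of_injective W.1.injective_subtype) f
  rw [← toDual_dereliction_of, hx, LinearMap.zero_apply, LinearMap.zero_apply]

/-- Only the left factors of `Δ c` matter. Their images under `φ` span a finite-dimensional `W`, and
following `φ` by a projection onto `W` does not change the functional of `c`. -/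
lemma mem_range_toDual_dereliction [IsAlgClosed k] {C : Type w} [AddCommGroup C] [Module k C]
    [Coalgebra k C] [Coalgebra.IsCocomm k C] (φ : C →ₗ[k] V) (c : C) :
    toDual φ c ∈ LinearMap.range (toDual (dereliction k V)) := by
  let r := Coalgebra.Repr.arbitrary k c
  obtain ⟨W, hW⟩ : ∃ W : FinSub k V, ∀ i ∈ r.index, φ (r.left i) ∈ W.1 :=
    ⟨⟨Submodule.span k ((fun i => φ (r.left i)) '' r.index),
      FiniteDimensional.span_of_finite k (r.index.finite_toSet.image _)⟩,
      fun i hi => Submodule.subset_span ⟨i, hi, rfl⟩⟩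
  -- With a linear retraction `q : V → W`, the map `q ∘ₗ φ` is defined on all of `C`, so no
  -- subcoalgebra containing `c` has to be chosen.
  obtain ⟨q, hq⟩ := W.1.subtype.exists_leftInverse_of_injective W.1.ker_subtype
  obtain ⟨y, hy⟩ := mem_range_toDual_derelictionFin k (toDual (q ∘ₗ φ) c)
    (finiteDimensional_span_dualMul_toDual (q ∘ₗ φ) c)
  refine ⟨Bang.of k W y, ?_⟩
  rw [← toDual_comp_eq_of_repr φ (W.1.subtype ∘ₗ q) c r fun i hi => ?_]
  · refine LinearMap.ext fun f => ?_
    rw [toDual_dereliction_of, hy, toDual_apply, toDual_apply, LinearMap.comp_assoc,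
      pairing_linear_comp W.1.subtype]
  · exact congrArg Subtype.val (LinearMap.congr_fun hq ⟨_, hW i hi⟩)

end Cofree

end CofreeCoalgebra

end

theorem proposition2p18 {k : Type*} [Field k] [IsAlgClosed k] [CharZero k]
    {V : Type*} [AddCommGroup V] [Module k V] :
    Coalgebra.IsCocomm k (CofreeCoalgebra.Bang k V) ∧
      ∀ (C : Type*) [AddCommGroup C] [Module k C] [Coalgebra k C] [Coalgebra.IsCocomm k C]
        (φ : C →ₗ[k] V),
        ∃! Φ : C →ₗc[k] CofreeCoalgebra.Bang k V,
          CofreeCoalgebra.dereliction k V ∘ₗ Φ.toLinearMap = φ := by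
  refine ⟨inferInstance, fun C _ _ _ _ φ => ?_⟩
  obtain ⟨Φ, hΦ⟩ := CofreeCoalgebra.exists_coalgHom_of_range_le
    CofreeCoalgebra.toDual_dereliction_injective
    (CofreeCoalgebra.mem_range_toDual_dereliction φ)
  exact ⟨Φ, hΦ, fun Ψ hΨ => CofreeCoalgebra.coalgHom_ext_of_injective
    CofreeCoalgebra.toDual_dereliction_injective (hΨ.trans hΦ.symm)⟩
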